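/- A \emph{prop} is a strict symmetric monoidal category whose objects are the natural numbers, with addition as tensor product of objects; a \emph{morphism of props} is a strict symmetric monoidal functor that is the identity on objects. Write $[n]$ for an $n$-element set. Let $k$ be a field and $L$ a set, and consider the following props (compositions of the first two are by pushout, and tensor products are by disjoint union). \begin{itemize} \item $\mathrm{FinCospan}$: morphisms $m\to n$ are isomorphism classes of cospans of finite sets $[m]\to N\leftarrow [n]$. \item $\mathrm{Circ}_L$: morphisms $m\to n$ are isomorphism classes of $L$-circuits, i.e. cospans of finite sets $[m]\to N\leftarrow [n]$ together with a finite set $E$ of edges and functions $s,t\colon E\to N$, $\ell\colon E\to L$. \item $F(L)$: the free prop on the signature with one generator $\ell\colon 1\to 1$ for each $\ell\in L$. \item $\mathrm{FinCorel}$: morphisms $m\to n$ are corelations, i.e. partitions of $[m]+[n]$; two corelations are composed by gluing them to the finest partition of $[m]+[n]+[p]$ in which elements lie in the same part whenever they do so in one of the two given partitions, and restricting it to $[m]+[p]$. \item $\mathrm{LagRel}_k$: morphisms $m\to n$ are Lagrangian subspaces (isotropic subspaces not properly contained in another isotropic subspace) of $\overline{(k\oplus k)^m}\oplus(k\oplus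 k)^n$, where $k\oplus k$ has the symplectic form $\omega((\phi,I),(\phi',I'))=\phi I'-\phi' I$, direct sums have the sum of the forms, and the bar means that the form is negated; composition is composition of relations and the tensor product is direct sum. \end{itemize} Let $H\colon \mathrm{FinCospan}\to\mathrm{FinCorel}$ send a cospan $[m]\to N\leftarrow[n]$ to the partition of $[m]+[n]$ into the nonempty fibres of $[m]+[n]\to N$. There are morphisms of props $\mathrm{FinCospan}\to\mathrm{Circ}_L$ (a cospan is a circuit without edges) and $F(L)\to\mathrm{Circ}_L$ (the generator $\ell$ is sent to the circuit with one edge, labelled $\ell$, from its input to its output). Then: \begin{enumerate} \item These two morphisms make $\mathrm{Circ}_L$ a coproduct of props, $\mathrm{Circ}_L\cong\mathrm{FinCospan}+F(L)$. \item There is a unique morphism of props $K\colon\mathrm{FinCorel}\to\mathrm{LagRel}_k$ that sends the one-part corelations $2\to1$, $0\to1$, $1\to2$, $1\to0$ respectively to \[\{(\phi_1,I_1,\phi_2,I_2,\phi_3,I_3):\phi_1=\phi_2=\phi_3,\ I_1+I_2=I_3\},\qquad \{(\phi,I): I=0\},\] \[\{(\phi_1,I_1,\phi_2,I_2,\phi_3,I_3):\phi_1=\phi_2=\phi_3,\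 I_1=I_2+I_3\},\qquad \{(\phi,I): I=0\}.\] \item For every choice of a Lagrangian relation $R_\ell$ from $k\oplus k$ to itself for each $\ell\in L$, there is a unique morphism of props \[\blacksquare\colon \mathrm{Circ}_L\cong\mathrm{FinCospan}+F(L)\to\mathrm{LagRel}_k\] such that $\blacksquare|_{\mathrm{FinCospan}}=K\circ H$ and $\blacksquare|_{F(L)}$ sends each $\ell\in L$ to $R_\ell$. \end{enumerate} -/

import Mathlib

universe u v w

/-! ## Props -/

/-- Transport of a morphism along equalities of its source and target. -/
def castHom {Hom : ℕ → ℕ → Type v} {m m' n n' : ℕ} (hm : m = m') (hn : n = n')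
    (f : Hom m n) : Hom m' n' :=
  hm ▸ hn ▸ f

/-- A prop: a strict symmetric monoidal category whose objects are the natural numbers, with
addition as the tensor product of objects.  Composition is written in diagrammatic order.
The associator and the unitors are identities, which is what the transports `castHom` express. -/
structure PROP where
  Hom : ℕ → ℕ → Type v
  id : ∀ n, Hom n n
  comp : ∀ {m n p}, Hom m n → Hom n p → Hom m p
  tensor : ∀ {m n m' n'}, Hom m n → Hom m' n' → Hom (m + m') (n + n')
  braid : ∀ m n, Hom (m + n) (n + m)
  id_comp : ∀ {m n} (f : Hom m n), comp (id m) f = f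
  comp_id : ∀ {m n} (f : Hom m n), comp f (id n) = f
  assoc : ∀ {m n p q} (f : Hom m n) (g : Hom n p) (h : Hom p q),
    comp (comp f g) h = comp f (comp g h)
  tensor_id : ∀ m n, tensor (id m) (id n) = id (m + n)
  tensor_comp : ∀ {m n p m' n' p'} (f : Hom m n) (g : Hom n p) (f' : Hom m' n') (g' : Hom n' p'),
    tensor (comp f g) (comp f' g') = comp (tensor f f') (tensor g g')
  tensor_assoc : ∀ {m n m' n' m'' n''} (f : Hom m n) (g : Hom m' n') (h : Hom m'' n''),
    castHom (Hom := Hom) (Nat.add_assoc m m' m'') (Nat.add_assoc n n' n'')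
      (tensor (tensor f g) h) = tensor f (tensor g h)
  id_tensor : ∀ {m n} (f : Hom m n),
    castHom (Hom := Hom) (Nat.zero_add m) (Nat.zero_add n) (tensor (id 0) f) = f
  tensor_unit : ∀ {m n} (f : Hom m n),
    castHom (Hom := Hom) (Nat.add_zero m) (Nat.add_zero n) (tensor f (id 0)) = f
  braid_natural : ∀ {m n m' n'} (f : Hom m n) (g : Hom m' n'),
    comp (tensor f g) (braid n n') = comp (braid m m') (tensor g f)
  braid_braid : ∀ m n, comp (braid m n) (braid n m) = id (m + n)
  hexagon : ∀ m n p,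
    castHom (Hom := Hom) (Nat.add_assoc m n p).symm (Nat.add_assoc n p m) (braid m (n + p)) =
      comp (castHom (Hom := Hom) rfl (Nat.add_assoc n m p) (tensor (braid m n) (id p)))
        (tensor (id n) (braid m p))

namespace PROP

/-- A morphism of props: a strict symmetric monoidal functor that is the identity on objects. -/
@[ext]
structure Morphism (P : PROP.{v}) (Q : PROP.{w}) where
  map : ∀ {m n}, P.Hom m n → Q.Hom m n
  map_id : ∀ n, map (P.id n) = Q.id n
  map_comp : ∀ {m n p} (f : P.Hom m n) (g : P.Hom n p),
    map (P.comp f g) = Q.comp (map f) (map g)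
  map_tensor : ∀ {m n m' n'} (f : P.Hom m n) (g : P.Hom m' n'),
    map (P.tensor f g) = Q.tensor (map f) (map g)
  map_braid : ∀ m n, map (P.braid m n) = Q.braid m n

/-- Composition of morphisms of props: first `F`, then `G`. -/
def Morphism.comp {P : PROP.{u}} {Q : PROP.{v}} {R : PROP.{w}} (F : Morphism P Q)
    (G : Morphism Q R) : Morphism P R where
  map f := G.map (F.map f)
  map_id n := by rw [F.map_id, G.map_id]
  map_comp f g := by rw [F.map_comp, G.map_comp]
  map_tensor f g := by rw [F.map_tensor, G.map_tensor]
  map_braid m n := by rw [F.map_braid, G.map_braid]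

/-- `i : P → C` and `j : Q → C` make `C` a coproduct of the props `P` and `Q`
(the universal property is tested on props in the universe `t`). -/
def IsCoproduct.{t, a, b, c} {P : PROP.{a}} {Q : PROP.{b}} {C : PROP.{c}}
    (i : Morphism P C) (j : Morphism Q C) : Prop :=
  ∀ (T : PROP.{t}) (f : Morphism P T) (g : Morphism Q T),
    ∃! h : Morphism C T, i.comp h = f ∧ j.comp h = g

end PROP

/-! ## The free prop on a signature -/

/-- Formal expressions in a signature `S`, where `S m n` is the set of generators `m → n`. -/
inductive PropTerm (S : ℕ → ℕ → Type u) : ℕ → ℕ → Type u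
  | gen {m n : ℕ} (s : S m n) : PropTerm S m n
  | id (n : ℕ) : PropTerm S n n
  | comp {m n p : ℕ} (f : PropTerm S m n) (g : PropTerm S n p) : PropTerm S m p
  | tensor {m n m' n' : ℕ} (f : PropTerm S m n) (g : PropTerm S m' n') :
      PropTerm S (m + m') (n + n')
  | braid (m n : ℕ) : PropTerm S (m + n) (n + m)

namespace PropTerm

/-- The congruence on expressions generated by the laws of a prop. -/
inductive Rel (S : ℕ → ℕ → Type u) : ∀ {m n : ℕ}, PropTerm S m n → PropTerm S m n → Prop
  | refl {m n} (f : PropTerm S m n) : Rel S f f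
  | symm {m n} {f g : PropTerm S m n} : Rel S f g → Rel S g f
  | trans {m n} {f g h : PropTerm S m n} : Rel S f g → Rel S g h → Rel S f h
  | comp_congr {m n p} {f f' : PropTerm S m n} {g g' : PropTerm S n p} :
      Rel S f f' → Rel S g g' → Rel S (comp f g) (comp f' g')
  | tensor_congr {m n m' n'} {f f' : PropTerm S m n} {g g' : PropTerm S m' n'} :
      Rel S f f' → Rel S g g' → Rel S (tensor f g) (tensor f' g')
  | id_comp {m n} (f : PropTerm S m n) : Rel S (comp (id m) f) f
  | comp_id {m n} (f : PropTerm S m n) : Rel S (comp f (id n)) f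
  | assoc {m n p q} (f : PropTerm S m n) (g : PropTerm S n p) (h : PropTerm S p q) :
      Rel S (comp (comp f g) h) (comp f (comp g h))
  | tensor_id (m n) : Rel S (tensor (id m) (id n)) (id (m + n))
  | tensor_comp {m n p m' n' p'} (f : PropTerm S m n) (g : PropTerm S n p)
      (f' : PropTerm S m' n') (g' : PropTerm S n' p') :
      Rel S (tensor (comp f g) (comp f' g')) (comp (tensor f f') (tensor g g'))
  | tensor_assoc {m n m' n' m'' n''} (f : PropTerm S m n) (g : PropTerm S m' n')
      (h : PropTerm S m'' n'') :
      Rel S (castHom (Hom := PropTerm S) (Nat.add_assoc m m' m'') (Nat.add_assoc n n' n'')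
        (tensor (tensor f g) h)) (tensor f (tensor g h))
  | id_tensor {m n} (f : PropTerm S m n) :
      Rel S (castHom (Hom := PropTerm S) (Nat.zero_add m) (Nat.zero_add n) (tensor (id 0) f)) f
  | tensor_unit {m n} (f : PropTerm S m n) :
      Rel S (castHom (Hom := PropTerm S) (Nat.add_zero m) (Nat.add_zero n) (tensor f (id 0))) f
  | braid_natural {m n m' n'} (f : PropTerm S m n) (g : PropTerm S m' n') :
      Rel S (comp (tensor f g) (braid n n')) (comp (braid m m') (tensor g f))
  | braid_braid (m n) : Rel S (comp (braid m n) (braid n m)) (id (m + n))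
  | hexagon (m n p) :
      Rel S (castHom (Hom := PropTerm S) (Nat.add_assoc m n p).symm (Nat.add_assoc n p m)
          (braid m (n + p)))
        (comp (castHom (Hom := PropTerm S) rfl (Nat.add_assoc n m p) (tensor (braid m n) (id p)))
          (tensor (id n) (braid m p)))

instance setoid (S : ℕ → ℕ → Type u) (m n : ℕ) : Setoid (PropTerm S m n) where
  r := Rel S
  iseqv := ⟨Rel.refl, Rel.symm, Rel.trans⟩

/-- The value of an expression in a prop, given the values of the generators. -/
def eval {S : ℕ → ℕ → Type u} (P : PROP.{v}) (φ : ∀ m n, S m n → P.Hom m n) :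
    ∀ {m n : ℕ}, PropTerm S m n → P.Hom m n
  | _, _, gen s => φ _ _ s
  | _, _, id n => P.id n
  | _, _, comp f g => P.comp (eval P φ f) (eval P φ g)
  | _, _, tensor f g => P.tensor (eval P φ f) (eval P φ g)
  | _, _, braid m n => P.braid m n

theorem eval_castHom {S : ℕ → ℕ → Type u} (P : PROP.{v}) (φ : ∀ m n, S m n → P.Hom m n)
    {m n m' n' : ℕ} (hm : m = m') (hn : n = n') (f : PropTerm S m n) :
    eval P φ (castHom (Hom := PropTerm S) hm hn f) =
      castHom (Hom := P.Hom) hm hn (eval P φ f) := by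
  subst hm hn; rfl

theorem eval_rel {S : ℕ → ℕ → Type u} (P : PROP.{v}) (φ : ∀ m n, S m n → P.Hom m n)
    {m n : ℕ} {f g : PropTerm S m n} (h : Rel S f g) : eval P φ f = eval P φ g := by
  induction h with
  | refl => rfl
  | symm _ ih => exact ih.symm
  | trans _ _ ih₁ ih₂ => exact ih₁.trans ih₂
  | comp_congr _ _ ih₁ ih₂ => simp only [eval, ih₁, ih₂]
  | tensor_congr _ _ ih₁ ih₂ => simp only [eval, ih₁, ih₂]
  | id_comp => exact P.id_comp _
  | comp_id => exact P.comp_id _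
  | assoc => exact P.assoc _ _ _
  | tensor_id => exact P.tensor_id _ _
  | tensor_comp => exact P.tensor_comp _ _ _ _
  | tensor_assoc => rw [eval_castHom]; exact P.tensor_assoc _ _ _
  | id_tensor => rw [eval_castHom]; exact P.id_tensor _
  | tensor_unit => rw [eval_castHom]; exact P.tensor_unit _
  | braid_natural => exact P.braid_natural _ _
  | braid_braid => exact P.braid_braid _ _
  | hexagon => simp only [eval, eval_castHom]; exact P.hexagon _ _ _

theorem mk_castHom {S : ℕ → ℕ → Type u} {m n m' n' : ℕ} (hm : m = m') (hn : n = n')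
    (f : PropTerm S m n) :
    castHom (Hom := fun m n => Quotient (setoid S m n)) hm hn (Quotient.mk _ f) =
      Quotient.mk _ (castHom (Hom := PropTerm S) hm hn f) := by
  subst hm hn; rfl

end PropTerm

/-- The free prop on a signature: expressions modulo the laws of a prop. -/
def freeProp (S : ℕ → ℕ → Type u) : PROP.{u} where
  Hom m n := Quotient (PropTerm.setoid S m n)
  id n := Quotient.mk _ (.id n)
  comp := Quotient.map₂ .comp fun _ _ h _ _ h' => .comp_congr h h'
  tensor := Quotient.map₂ .tensor fun _ _ h _ _ h' => .tensor_congr h h'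
  braid m n := Quotient.mk _ (.braid m n)
  id_comp := by rintro m n ⟨f⟩; exact Quotient.sound (.id_comp f)
  comp_id := by rintro m n ⟨f⟩; exact Quotient.sound (.comp_id f)
  assoc := by rintro m n p q ⟨f⟩ ⟨g⟩ ⟨h⟩; exact Quotient.sound (.assoc f g h)
  tensor_id m n := Quotient.sound (.tensor_id m n)
  tensor_comp := by
    rintro m n p m' n' p' ⟨f⟩ ⟨g⟩ ⟨f'⟩ ⟨g'⟩; exact Quotient.sound (.tensor_comp f g f' g')
  tensor_assoc := by
    rintro m n m' n' m'' n'' ⟨f⟩ ⟨g⟩ ⟨h⟩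
    exact (PropTerm.mk_castHom _ _ _).trans (Quotient.sound (.tensor_assoc f g h))
  id_tensor := by
    rintro m n ⟨f⟩
    exact (PropTerm.mk_castHom _ _ _).trans (Quotient.sound (.id_tensor f))
  tensor_unit := by
    rintro m n ⟨f⟩
    exact (PropTerm.mk_castHom _ _ _).trans (Quotient.sound (.tensor_unit f))
  braid_natural := by
    rintro m n m' n' ⟨f⟩ ⟨g⟩; exact Quotient.sound (.braid_natural f g)
  braid_braid m n := Quotient.sound (.braid_braid m n)
  hexagon m n p := by
    simp only [Quotient.map₂_mk]
    rw [PropTerm.mk_castHom, PropTerm.mk_castHom]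
    exact Quotient.sound (PropTerm.Rel.hexagon m n p)

/-- A generator, as a morphism of the free prop. -/
def freeProp.of {S : ℕ → ℕ → Type u} {m n : ℕ} (s : S m n) : (freeProp S).Hom m n :=
  Quotient.mk (PropTerm.setoid S m n) (.gen s)

/-- The morphism out of a free prop with prescribed values on the generators. -/
def freeProp.lift {S : ℕ → ℕ → Type u} (P : PROP.{v}) (φ : ∀ m n, S m n → P.Hom m n) :
    PROP.Morphism (freeProp S) P where
  map := Quotient.lift (PropTerm.eval P φ) fun _ _ h => PropTerm.eval_rel P φ h
  map_id _ := rfl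
  map_comp := by rintro m n p ⟨f⟩ ⟨g⟩; rfl
  map_tensor := by rintro m n m' n' ⟨f⟩ ⟨g⟩; rfl
  map_braid _ _ := rfl

/-- The signature with one generator `1 → 1` for each element of `L`, and no others. -/
inductive LabelSig (L : Type u) : ℕ → ℕ → Type u
  | label (l : L) : LabelSig L 1 1

/-- `F(L)`, the prop for `L`-actions. -/
def labelProp (L : Type u) : PROP.{u} := freeProp (LabelSig L)

/-! ## Symmetric monoidal categories of finite sets, and the props they give -/

/-- The operations of a symmetric monoidal category whose objects are the finite sets, with
disjoint union as tensor product.  Every bijection `X ≃ Y` gives a morphism `ofEquiv`; the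
identities, associators, unitors and braidings are those given by the obvious bijections. -/
structure FinSetOps where
  Hom : ∀ (X Y : Type) [Fintype X] [Fintype Y], Type v
  ofEquiv : ∀ {X Y : Type} [Fintype X] [Fintype Y], X ≃ Y → Hom X Y
  comp : ∀ {X Y Z : Type} [Fintype X] [Fintype Y] [Fintype Z], Hom X Y → Hom Y Z → Hom X Z
  tensor : ∀ {X Y X' Y' : Type} [Fintype X] [Fintype Y] [Fintype X'] [Fintype Y'],
    Hom X Y → Hom X' Y' → Hom (X ⊕ X') (Y ⊕ Y')

namespace FinSetOps

/-- The laws of a symmetric monoidal category for such operations. -/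
structure Lawful (O : FinSetOps.{v}) : Prop where
  id_comp : ∀ {X Y : Type} [Fintype X] [Fintype Y] (f : O.Hom X Y),
    O.comp (O.ofEquiv (Equiv.refl X)) f = f
  comp_id : ∀ {X Y : Type} [Fintype X] [Fintype Y] (f : O.Hom X Y),
    O.comp f (O.ofEquiv (Equiv.refl Y)) = f
  assoc : ∀ {X Y Z W : Type} [Fintype X] [Fintype Y] [Fintype Z] [Fintype W]
    (f : O.Hom X Y) (g : O.Hom Y Z) (h : O.Hom Z W),
    O.comp (O.comp f g) h = O.comp f (O.comp g h)
  ofEquiv_trans : ∀ {X Y Z : Type} [Fintype X] [Fintype Y] [Fintype Z] (e : X ≃ Y) (e' : Y ≃ Z),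
    O.comp (O.ofEquiv e) (O.ofEquiv e') = O.ofEquiv (e.trans e')
  tensor_ofEquiv : ∀ {X Y X' Y' : Type} [Fintype X] [Fintype Y] [Fintype X'] [Fintype Y']
    (e : X ≃ Y) (e' : X' ≃ Y'),
    O.tensor (O.ofEquiv e) (O.ofEquiv e') = O.ofEquiv (Equiv.sumCongr e e')
  tensor_comp : ∀ {X Y Z X' Y' Z' : Type} [Fintype X] [Fintype Y] [Fintype Z] [Fintype X']
    [Fintype Y'] [Fintype Z'] (f : O.Hom X Y) (g : O.Hom Y Z) (f' : O.Hom X' Y')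
    (g' : O.Hom Y' Z'),
    O.tensor (O.comp f g) (O.comp f' g') = O.comp (O.tensor f f') (O.tensor g g')
  assoc_natural : ∀ {X Y X' Y' X'' Y'' : Type} [Fintype X] [Fintype Y] [Fintype X']
    [Fintype Y'] [Fintype X''] [Fintype Y''] (f : O.Hom X Y) (g : O.Hom X' Y')
    (h : O.Hom X'' Y''),
    O.comp (O.tensor (O.tensor f g) h) (O.ofEquiv (Equiv.sumAssoc Y Y' Y'')) =
      O.comp (O.ofEquiv (Equiv.sumAssoc X X' X'')) (O.tensor f (O.tensor g h))
  unit_natural : ∀ {X Y : Type} [Fintype X] [Fintype Y] (f : O.Hom X Y),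
    O.comp (O.tensor (O.ofEquiv (Equiv.refl (Fin 0))) f) (O.ofEquiv (Equiv.emptySum (Fin 0) Y)) =
      O.comp (O.ofEquiv (Equiv.emptySum (Fin 0) X)) f
  braid_natural : ∀ {X Y X' Y' : Type} [Fintype X] [Fintype Y] [Fintype X'] [Fintype Y']
    (f : O.Hom X Y) (g : O.Hom X' Y'),
    O.comp (O.tensor f g) (O.ofEquiv (Equiv.sumComm Y Y')) =
      O.comp (O.ofEquiv (Equiv.sumComm X X')) (O.tensor g f)

theorem castHom_eq {O : FinSetOps.{v}} (hO : O.Lawful) {m n m' n' : ℕ} (hm : m = m') (hn : n = n')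
    (f : O.Hom (Fin m) (Fin n)) :
    castHom (Hom := fun m n => O.Hom (Fin m) (Fin n)) hm hn f =
      O.comp (O.ofEquiv (finCongr hm.symm)) (O.comp f (O.ofEquiv (finCongr hn))) := by
  subst hm hn
  simp only [finCongr_refl, hO.id_comp, hO.comp_id]
  rfl

/-- Precomposition and postcomposition with bijections. -/
def conj (O : FinSetOps.{v}) {X Y X' Y' : Type} [Fintype X] [Fintype Y] [Fintype X'] [Fintype Y']
    (e : X' ≃ X) (f : O.Hom X Y) (e' : Y ≃ Y') : O.Hom X' Y' :=
  O.comp (O.ofEquiv e) (O.comp f (O.ofEquiv e'))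

theorem conj_refl {O : FinSetOps.{v}} (hO : O.Lawful) {X Y : Type} [Fintype X] [Fintype Y] (f : O.Hom X Y) :
    O.conj (Equiv.refl X) f (Equiv.refl Y) = f := by
  rw [conj, hO.id_comp, hO.comp_id]

theorem conj_conj {O : FinSetOps.{v}} (hO : O.Lawful) {X Y X' Y' X'' Y'' : Type} [Fintype X] [Fintype Y] [Fintype X']
    [Fintype Y'] [Fintype X''] [Fintype Y''] (a : X'' ≃ X') (e : X' ≃ X) (f : O.Hom X Y)
    (e' : Y ≃ Y') (b : Y' ≃ Y'') :
    O.conj a (O.conj e f e') b = O.conj (a.trans e) f (e'.trans b) := by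
  simp only [conj, ← hO.ofEquiv_trans, hO.assoc]

theorem conj_comp_conj {O : FinSetOps.{v}} (hO : O.Lawful) {X Y Z X' Y' Z' : Type} [Fintype X] [Fintype Y] [Fintype Z]
    [Fintype X'] [Fintype Y'] [Fintype Z'] (a : X' ≃ X) (f : O.Hom X Y) (b : Y ≃ Y')
    (c : Y' ≃ Y) (g : O.Hom Y Z) (d : Z ≃ Z') (h : b.trans c = Equiv.refl Y) :
    O.comp (O.conj a f b) (O.conj c g d) = O.conj a (O.comp f g) d := by
  simp only [conj, hO.assoc]
  rw [← hO.assoc (O.ofEquiv b), hO.ofEquiv_trans, h, hO.id_comp]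

theorem tensor_conj {O : FinSetOps.{v}} (hO : O.Lawful) {X Y X' Y' A B A' B' : Type} [Fintype X] [Fintype Y]
    [Fintype X'] [Fintype Y'] [Fintype A] [Fintype B] [Fintype A'] [Fintype B']
    (a : A ≃ X) (f : O.Hom X Y) (b : Y ≃ B) (a' : A' ≃ X') (f' : O.Hom X' Y') (b' : Y' ≃ B') :
    O.tensor (O.conj a f b) (O.conj a' f' b') =
      O.conj (Equiv.sumCongr a a') (O.tensor f f') (Equiv.sumCongr b b') := by
  simp only [conj, hO.tensor_comp, hO.tensor_ofEquiv]

theorem conj_ofEquiv {O : FinSetOps.{v}} (hO : O.Lawful) {X Y X' Y' : Type} [Fintype X] [Fintype Y] [Fintype X']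
    [Fintype Y'] (e : X' ≃ X) (f : X ≃ Y) (e' : Y ≃ Y') :
    O.conj e (O.ofEquiv f) e' = O.ofEquiv (e.trans (f.trans e')) := by
  simp only [conj, hO.ofEquiv_trans]

theorem comp_ofEquiv_eq {O : FinSetOps.{v}} (hO : O.Lawful) {X Y Y' : Type} [Fintype X] [Fintype Y] [Fintype Y']
    (f : O.Hom X Y) (e : Y ≃ Y') : O.comp f (O.ofEquiv e) = O.conj (Equiv.refl X) f e := by
  rw [conj, hO.id_comp]

theorem ofEquiv_comp_eq {O : FinSetOps.{v}} (hO : O.Lawful) {X Y X' : Type} [Fintype X] [Fintype Y] [Fintype X']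
    (e : X' ≃ X) (f : O.Hom X Y) : O.comp (O.ofEquiv e) f = O.conj e f (Equiv.refl Y) := by
  rw [conj, hO.comp_id]

theorem conj_eq_iff {O : FinSetOps.{v}} (hO : O.Lawful) {X Y X' Y' A B : Type} [Fintype X] [Fintype Y] [Fintype X']
    [Fintype Y'] [Fintype A] [Fintype B] {f : O.Hom X Y} {g : O.Hom X' Y'} {a : X ≃ X'}
    {b : Y ≃ Y'} (h : O.comp f (O.ofEquiv b) = O.comp (O.ofEquiv a) g)
    (p : A ≃ X) (q : Y ≃ B) (p' : A ≃ X') (q' : Y' ≃ B) (hp : p' = p.trans a)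
    (hq : q = b.trans q') : O.conj p f q = O.conj p' g q' := by
  subst hp hq
  simp only [conj, ← hO.ofEquiv_trans, hO.assoc]
  rw [← hO.assoc f, h, hO.assoc]

/-- The prop given by such a category: `Hom m n` consists of the morphisms between the standard
finite sets `Fin m` and `Fin n`, and disjoint unions of standard finite sets are identified with
standard finite sets by listing the elements of the first summand first. -/
def toPROP (O : FinSetOps.{v}) (hO : O.Lawful) : PROP.{v} where
  Hom m n := O.Hom (Fin m) (Fin n)
  id n := O.ofEquiv (Equiv.refl (Fin n))
  comp f g := O.comp f g
  tensor f g := O.conj finSumFinEquiv.symm (O.tensor f g) finSumFinEquiv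
  braid m n := O.ofEquiv ((finSumFinEquiv.symm.trans (Equiv.sumComm _ _)).trans finSumFinEquiv)
  id_comp f := hO.id_comp f
  comp_id f := hO.comp_id f
  assoc f g h := hO.assoc f g h
  tensor_id m n := by
    rw [hO.tensor_ofEquiv, conj_ofEquiv hO]
    congr 1
    ext; simp
  tensor_comp f g f' g' := by
    rw [hO.tensor_comp, conj_comp_conj hO _ _ _ _ _ _ (by ext; simp)]
  tensor_assoc {m n m' n' m'' n''} f g h := by
    rw [castHom_eq hO]
    change O.conj _ _ _ = _
    conv_lhs => rw [← conj_refl hO h]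
    conv_rhs => rw [← conj_refl hO f]
    simp only [tensor_conj hO, conj_conj hO]
    refine conj_eq_iff hO (hO.assoc_natural f g h) _ _ _ _ ?_ ?_
    · apply Equiv.symm_bijective.injective
      ext (x | x | x) <;> simp [finSumFinEquiv, Nat.add_assoc]
    · ext ((x | x) | x) <;> simp [finSumFinEquiv, Nat.add_assoc]
  id_tensor {m n} f := by
    rw [castHom_eq hO]
    change O.conj _ _ _ = _
    conv_rhs => rw [← conj_refl hO f]
    rw [conj_conj hO]
    refine conj_eq_iff hO (hO.unit_natural f) _ _ _ _ ?_ ?_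
    · apply Equiv.symm_bijective.injective
      ext x; simp [finSumFinEquiv]
    · ext (x | x)
      · exact x.elim0
      · simp [finSumFinEquiv]
  tensor_unit {m n} f := by
    rw [castHom_eq hO]
    change O.conj _ _ _ = _
    conv_rhs => rw [← conj_refl hO f]
    rw [conj_conj hO]
    have h₁ := hO.braid_natural f (O.ofEquiv (Equiv.refl (Fin 0)))
    rw [← conj_refl hO (O.tensor f (O.ofEquiv (Equiv.refl (Fin 0))))]
    rw [conj_eq_iff hO h₁ _ _ (Equiv.sumComm _ _) (Equiv.sumComm _ _) rfl (by ext x; simp),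
      conj_conj hO]
    refine conj_eq_iff hO (hO.unit_natural f) _ _ _ _ ?_ ?_
    · apply Equiv.symm_bijective.injective
      ext x; simp [finSumFinEquiv]
    · ext (x | x)
      · exact x.elim0
      · simp [finSumFinEquiv]
  braid_natural {m n m' n'} f g := by
    rw [comp_ofEquiv_eq hO, ofEquiv_comp_eq hO, conj_conj hO, conj_conj hO]
    refine conj_eq_iff hO (hO.braid_natural f g) _ _ _ _ ?_ ?_
    · apply Equiv.symm_bijective.injective
      ext (x | x) <;> simp [finSumFinEquiv]
    · ext (x | x) <;> simp [finSumFinEquiv]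
  braid_braid m n := by
    rw [hO.ofEquiv_trans]
    congr 1
    ext x; simp
  hexagon m n p := by
    rw [castHom_eq hO, castHom_eq hO]
    simp only [hO.tensor_ofEquiv, conj_ofEquiv hO, hO.ofEquiv_trans]
    congr 1
    apply Equiv.symm_bijective.injective
    ext x
    obtain ⟨x | x, rfl⟩ := finSumFinEquiv.surjective x
    · have h₁ : Fin.cast (Nat.add_assoc n p m).symm (finSumFinEquiv (Sum.inl x)) =
          finSumFinEquiv (Sum.inl (finSumFinEquiv (Sum.inl x))) := by ext; simp [finSumFinEquiv]
      have h₂ : Fin.cast (Nat.add_assoc n m p).symm (finSumFinEquiv (Sum.inl x)) =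
          finSumFinEquiv (Sum.inl (finSumFinEquiv (Sum.inl x))) := by ext; simp [finSumFinEquiv]
      simp [h₁, h₂, -finSumFinEquiv_apply_left]
      try simp [finSumFinEquiv]
    · obtain ⟨x | x, rfl⟩ := finSumFinEquiv.surjective x
      · have h₁ : Fin.cast (Nat.add_assoc n p m).symm
            (finSumFinEquiv (Sum.inr (finSumFinEquiv (Sum.inl x)))) =
            finSumFinEquiv (Sum.inl (finSumFinEquiv (Sum.inr x))) := by
          ext; simp [finSumFinEquiv]
        have h₂ : Fin.cast (Nat.add_assoc n m p).symm
            (finSumFinEquiv (Sum.inr (finSumFinEquiv (Sum.inr x)))) =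
            finSumFinEquiv (Sum.inr x) := by
          ext; simp [finSumFinEquiv, Nat.add_assoc]
        simp [h₁, h₂, -finSumFinEquiv_apply_left, -finSumFinEquiv_apply_right]
        try simp [finSumFinEquiv, Nat.add_assoc]
      · have h₁ : Fin.cast (Nat.add_assoc n p m).symm
            (finSumFinEquiv (Sum.inr (finSumFinEquiv (Sum.inr x)))) =
            finSumFinEquiv (Sum.inr x) := by
          ext; simp [finSumFinEquiv, Nat.add_assoc]
        have h₂ : Fin.cast (Nat.add_assoc n m p).symm
            (finSumFinEquiv (Sum.inr (finSumFinEquiv (Sum.inl x)))) =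
            finSumFinEquiv (Sum.inl (finSumFinEquiv (Sum.inr x))) := by
          ext; simp [finSumFinEquiv]
        simp [h₁, h₂, -finSumFinEquiv_apply_left, -finSumFinEquiv_apply_right]
        try simp [finSumFinEquiv]

/-- A map of such operations that is the identity on objects. -/
structure Map (O : FinSetOps.{v}) (O' : FinSetOps.{w}) where
  map : ∀ {X Y : Type} [Fintype X] [Fintype Y], O.Hom X Y → O'.Hom X Y
  map_ofEquiv : ∀ {X Y : Type} [Fintype X] [Fintype Y] (e : X ≃ Y),
    map (O.ofEquiv e) = O'.ofEquiv e
  map_comp : ∀ {X Y Z : Type} [Fintype X] [Fintype Y] [Fintype Z] (f : O.Hom X Y)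
    (g : O.Hom Y Z), map (O.comp f g) = O'.comp (map f) (map g)
  map_tensor : ∀ {X Y X' Y' : Type} [Fintype X] [Fintype Y] [Fintype X'] [Fintype Y']
    (f : O.Hom X Y) (g : O.Hom X' Y'), map (O.tensor f g) = O'.tensor (map f) (map g)

/-- The morphism of props given by such a map. -/
def Map.toMorphism {O : FinSetOps.{v}} {O' : FinSetOps.{w}} (F : Map O O') (hO : O.Lawful)
    (hO' : O'.Lawful) : PROP.Morphism (O.toPROP hO) (O'.toPROP hO') where
  map f := F.map f
  map_id _ := F.map_ofEquiv _
  map_comp f g := F.map_comp f g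
  map_tensor f g := by
    have h := F.map_tensor f g
    simp only [toPROP, conj, F.map_comp, F.map_ofEquiv]
    exact congrArg (fun t => O'.comp _ (O'.comp t _)) h
  map_braid _ _ := F.map_ofEquiv _

theorem Map.lawful {O : FinSetOps.{v}} {O' : FinSetOps.{w}} (F : Map O O')
    (hF : ∀ (X Y : Type) [Fintype X] [Fintype Y],
      Function.Surjective (F.map : O.Hom X Y → O'.Hom X Y))
    (hO : O.Lawful) : O'.Lawful where
  id_comp f := by
    obtain ⟨f, rfl⟩ := hF _ _ f
    simp only [← F.map_ofEquiv, ← F.map_comp, hO.id_comp]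
  comp_id f := by
    obtain ⟨f, rfl⟩ := hF _ _ f
    simp only [← F.map_ofEquiv, ← F.map_comp, hO.comp_id]
  assoc f g h := by
    obtain ⟨f, rfl⟩ := hF _ _ f
    obtain ⟨g, rfl⟩ := hF _ _ g
    obtain ⟨h, rfl⟩ := hF _ _ h
    simp only [← F.map_comp, hO.assoc]
  ofEquiv_trans e e' := by
    simp only [← F.map_ofEquiv, ← F.map_comp, hO.ofEquiv_trans]
  tensor_ofEquiv e e' := by
    simp only [← F.map_ofEquiv, ← F.map_tensor, hO.tensor_ofEquiv]
  tensor_comp f g f' g' := by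
    obtain ⟨f, rfl⟩ := hF _ _ f
    obtain ⟨g, rfl⟩ := hF _ _ g
    obtain ⟨f', rfl⟩ := hF _ _ f'
    obtain ⟨g', rfl⟩ := hF _ _ g'
    simp only [← F.map_comp, ← F.map_tensor, hO.tensor_comp]
  assoc_natural f g h := by
    obtain ⟨f, rfl⟩ := hF _ _ f
    obtain ⟨g, rfl⟩ := hF _ _ g
    obtain ⟨h, rfl⟩ := hF _ _ h
    simp only [← F.map_comp, ← F.map_tensor, ← F.map_ofEquiv, hO.assoc_natural]
  unit_natural f := by
    obtain ⟨f, rfl⟩ := hF _ _ f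
    simp only [← F.map_comp, ← F.map_tensor, ← F.map_ofEquiv, hO.unit_natural]
  braid_natural f g := by
    obtain ⟨f, rfl⟩ := hF _ _ f
    obtain ⟨g, rfl⟩ := hF _ _ g
    simp only [← F.map_comp, ← F.map_tensor, ← F.map_ofEquiv, hO.braid_natural]

end FinSetOps

/-! ## Cospans and circuits -/

/-- The pushout of `f : Y → A` and `g : Y → B` in the category of sets. -/
def Pushout {Y A B : Type} (f : Y → A) (g : Y → B) : Type :=
  Quot fun a b : A ⊕ B => ∃ y, a = Sum.inl (f y) ∧ b = Sum.inr (g y)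

namespace Pushout

variable {Y A B : Type} {f : Y → A} {g : Y → B}

/-- The first coprojection. -/
def inl (f : Y → A) (g : Y → B) (a : A) : Pushout f g := Quot.mk _ (Sum.inl a)

/-- The second coprojection. -/
def inr (f : Y → A) (g : Y → B) (b : B) : Pushout f g := Quot.mk _ (Sum.inr b)

theorem glue (y : Y) : inl f g (f y) = inr f g (g y) := Quot.sound ⟨y, rfl, rfl⟩

/-- The map out of a pushout given by two compatible maps. -/
def desc {T : Type} (a : A → T) (b : B → T) (h : ∀ y, a (f y) = b (g y)) : Pushout f g → T :=
  Quot.lift (Sum.elim a b) (by rintro _ _ ⟨y, rfl, rfl⟩; exact h y)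

@[simp] theorem desc_inl {T : Type} (a : A → T) (b : B → T) (h : ∀ y, a (f y) = b (g y)) (x : A) :
    desc a b h (inl f g x) = a x := rfl

@[simp] theorem desc_inr {T : Type} (a : A → T) (b : B → T) (h : ∀ y, a (f y) = b (g y)) (x : B) :
    desc a b h (inr f g x) = b x := rfl

theorem ind {motive : Pushout f g → Prop} (hl : ∀ a, motive (inl f g a))
    (hr : ∀ b, motive (inr f g b)) (x : Pushout f g) : motive x := by
  rcases x with ⟨a | b⟩
  exacts [hl a, hr b]

instance [Finite A] [Finite B] : Finite (Pushout f g) := Quot.finite _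

end Pushout

/-- A cospan of finite sets from `X` to `Y`. -/
structure Cospan (X Y : Type) where
  N : Type
  finite_N : Finite N
  inp : X → N
  out : Y → N

attribute [instance] Cospan.finite_N

/-- An `L`-circuit from `X` to `Y`: a cospan `X → N ← Y` of finite sets together with an
`L`-graph with `N` as its set of nodes. -/
structure Circuit (L : Type u) (X Y : Type) extends Cospan X Y where
  E : Type
  finite_E : Finite E
  src : E → N
  tgt : E → N
  lab : E → L

attribute [instance] Circuit.finite_E

namespace Cospan

/-- Isomorphism of cospans. -/
def Iso {X Y : Type} (c d : Cospan X Y) : Prop :=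
  ∃ e : c.N ≃ d.N, (∀ x, e (c.inp x) = d.inp x) ∧ ∀ y, e (c.out y) = d.out y

instance setoid (X Y : Type) : Setoid (Cospan X Y) where
  r := Iso
  iseqv :=
    { refl := fun _ => ⟨Equiv.refl _, fun _ => rfl, fun _ => rfl⟩
      symm := by
        rintro c d ⟨e, hi, ho⟩
        exact ⟨e.symm, fun x => by rw [← hi, e.symm_apply_apply],
          fun y => by rw [← ho, e.symm_apply_apply]⟩
      trans := by
        rintro c d k ⟨e, hi, ho⟩ ⟨e', hi', ho'⟩
        exact ⟨e.trans e', fun x => by simp [hi, hi'], fun y => by simp [ho, ho']⟩ }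

/-- A bijection as a cospan. -/
def ofEquiv {X Y : Type} [Fintype Y] (e : X ≃ Y) : Cospan X Y where
  N := Y
  finite_N := inferInstance
  inp := e
  out := id

/-- Composition of cospans by pushout. -/
def comp {X Y Z : Type} (c : Cospan X Y) (d : Cospan Y Z) : Cospan X Z where
  N := Pushout c.out d.inp
  finite_N := inferInstance
  inp x := Pushout.inl _ _ (c.inp x)
  out z := Pushout.inr _ _ (d.out z)

/-- Disjoint union of cospans. -/
def tensor {X Y X' Y' : Type} (c : Cospan X Y) (d : Cospan X' Y') :
    Cospan (X ⊕ X') (Y ⊕ Y') where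
  N := c.N ⊕ d.N
  finite_N := inferInstance
  inp := Sum.map c.inp d.inp
  out := Sum.map c.out d.out

end Cospan

namespace Circuit

variable {L : Type u}

/-- Isomorphism of circuits: bijections between the nodes and between the edges that preserve
inputs, outputs, sources, targets and labels. -/
def Iso {X Y : Type} (c d : Circuit L X Y) : Prop :=
  ∃ (e : c.N ≃ d.N) (a : c.E ≃ d.E), (∀ x, e (c.inp x) = d.inp x) ∧
    (∀ y, e (c.out y) = d.out y) ∧ (∀ i, e (c.src i) = d.src (a i)) ∧
    (∀ i, e (c.tgt i) = d.tgt (a i)) ∧ ∀ i, c.lab i = d.lab (a i)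

instance setoid (L : Type u) (X Y : Type) : Setoid (Circuit L X Y) where
  r := Iso
  iseqv :=
    { refl := fun _ => ⟨Equiv.refl _, Equiv.refl _, fun _ => rfl, fun _ => rfl, fun _ => rfl,
        fun _ => rfl, fun _ => rfl⟩
      symm := by
        rintro c d ⟨e, a, hi, ho, hs, ht, hl⟩
        refine ⟨e.symm, a.symm, fun x => ?_, fun x => ?_, fun x => ?_, fun x => ?_, fun x => ?_⟩
        · rw [← hi, e.symm_apply_apply]
        · rw [← ho, e.symm_apply_apply]
        · rw [e.symm_apply_eq, hs, a.apply_symm_apply]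
        · rw [e.symm_apply_eq, ht, a.apply_symm_apply]
        · rw [hl, a.apply_symm_apply]
      trans := by
        rintro c d k ⟨e, a, hi, ho, hs, ht, hl⟩ ⟨e', a', hi', ho', hs', ht', hl'⟩
        exact ⟨e.trans e', a.trans a', fun x => by simp [hi, hi'], fun y => by simp [ho, ho'],
          fun x => by simp [hs, hs'], fun x => by simp [ht, ht'], fun x => by simp [hl, hl']⟩ }

/-- A cospan as a circuit without edges. -/
def ofCospan (L : Type u) {X Y : Type} (c : Cospan X Y) : Circuit L X Y where
  toCospan := c
  E := Empty
  finite_E := inferInstance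
  src := Empty.elim
  tgt := Empty.elim
  lab := Empty.elim

instance {X Y : Type} (c : Cospan X Y) : IsEmpty (ofCospan L c).E :=
  inferInstanceAs (IsEmpty Empty)

/-- The circuit with one edge, labelled `l`, from its input to its output. -/
def edge (l : L) : Circuit L (Fin 1) (Fin 1) where
  N := Fin 2
  finite_N := inferInstance
  inp _ := 0
  out _ := 1
  E := Unit
  finite_E := inferInstance
  src _ := 0
  tgt _ := 1
  lab _ := l

/-- Composition of circuits: the underlying cospans are composed by pushout, and the graphs are
glued along the identified nodes. -/
def comp {X Y Z : Type} (c : Circuit L X Y) (d : Circuit L Y Z) : Circuit L X Z where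
  toCospan := c.toCospan.comp d.toCospan
  E := c.E ⊕ d.E
  finite_E := inferInstance
  src := Sum.elim (fun i => Pushout.inl _ _ (c.src i)) fun i => Pushout.inr _ _ (d.src i)
  tgt := Sum.elim (fun i => Pushout.inl _ _ (c.tgt i)) fun i => Pushout.inr _ _ (d.tgt i)
  lab := Sum.elim c.lab d.lab

/-- Disjoint union of circuits. -/
def tensor {X Y X' Y' : Type} (c : Circuit L X Y) (d : Circuit L X' Y') :
    Circuit L (X ⊕ X') (Y ⊕ Y') where
  toCospan := c.toCospan.tensor d.toCospan
  E := c.E ⊕ d.E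
  finite_E := inferInstance
  src := Sum.map c.src d.src
  tgt := Sum.map c.tgt d.tgt
  lab := Sum.elim c.lab d.lab

theorem comp_congr {X Y Z : Type} {c c' : Circuit L X Y} {d d' : Circuit L Y Z} (h : c ≈ c')
    (h' : d ≈ d') : c.comp d ≈ c'.comp d' := by
  obtain ⟨e, a, hi, ho, hs, ht, hl⟩ := h
  obtain ⟨e', a', hi', ho', hs', ht', hl'⟩ := h'
  refine ⟨⟨Pushout.desc (fun x => Pushout.inl _ _ (e x)) (fun x => Pushout.inr _ _ (e' x)) ?_,
    Pushout.desc (fun x => Pushout.inl _ _ (e.symm x)) (fun x => Pushout.inr _ _ (e'.symm x)) ?_,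
    ?_, ?_⟩, Equiv.sumCongr a a', ?_, ?_, ?_, ?_, ?_⟩
  · intro y
    rw [ho, hi']
    exact Pushout.glue y
  · intro y
    rw [← ho, ← hi', e.symm_apply_apply, e'.symm_apply_apply]
    exact Pushout.glue y
  · exact Pushout.ind (fun x => congrArg (Pushout.inl _ _) (e.symm_apply_apply x))
      (fun x => congrArg (Pushout.inr _ _) (e'.symm_apply_apply x))
  · exact Pushout.ind (fun x => congrArg (Pushout.inl _ _) (e.apply_symm_apply x))
      (fun x => congrArg (Pushout.inr _ _) (e'.apply_symm_apply x))
  · exact fun x => congrArg (Pushout.inl _ _) (hi x)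
  · exact fun x => congrArg (Pushout.inr _ _) (ho' x)
  · rintro (x | x)
    exacts [congrArg (Pushout.inl _ _) (hs x), congrArg (Pushout.inr _ _) (hs' x)]
  · rintro (x | x)
    exacts [congrArg (Pushout.inl _ _) (ht x), congrArg (Pushout.inr _ _) (ht' x)]
  · rintro (x | x)
    exacts [hl x, hl' x]

theorem tensor_congr {X Y X' Y' : Type} {c c' : Circuit L X Y} {d d' : Circuit L X' Y'}
    (h : c ≈ c') (h' : d ≈ d') : c.tensor d ≈ c'.tensor d' := by
  obtain ⟨e, a, hi, ho, hs, ht, hl⟩ := h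
  obtain ⟨e', a', hi', ho', hs', ht', hl'⟩ := h'
  refine ⟨Equiv.sumCongr e e', Equiv.sumCongr a a', ?_, ?_, ?_, ?_, ?_⟩ <;> rintro (x | x)
  exacts [congrArg Sum.inl (hi x), congrArg Sum.inr (hi' x), congrArg Sum.inl (ho x),
    congrArg Sum.inr (ho' x), congrArg Sum.inl (hs x), congrArg Sum.inr (hs' x),
    congrArg Sum.inl (ht x), congrArg Sum.inr (ht' x), hl x, hl' x]

/-- Change of inputs and outputs along functions. -/
def reindex {X Y X' Y' : Type} (f : X' → X) (c : Circuit L X Y) (g : Y' → Y) :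
    Circuit L X' Y' where
  N := c.N
  finite_N := c.finite_N
  inp := c.inp ∘ f
  out := c.out ∘ g
  E := c.E
  finite_E := c.finite_E
  src := c.src
  tgt := c.tgt
  lab := c.lab

theorem ofEquiv_comp {X Y Z : Type} [Fintype Y] (e : X ≃ Y) (c : Circuit L Y Z) :
    (ofCospan L (Cospan.ofEquiv e)).comp c ≈ c.reindex e id := by
  refine ⟨⟨Pushout.desc (fun y => c.inp y) id fun _ => rfl, fun x => Pushout.inr _ _ x, ?_, ?_⟩,
    Equiv.emptySum _ _, ?_, ?_, ?_, ?_, ?_⟩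
  · refine Pushout.ind (fun y => ?_) fun x => rfl
    exact (Pushout.glue (f := (Cospan.ofEquiv e).out) (g := c.inp) y).symm
  · intro x; rfl
  · intro x; rfl
  · intro x; rfl
  all_goals rintro (x | x)
  all_goals first | exact isEmptyElim (α := Empty) x | rfl

theorem comp_ofEquiv {X Y Z : Type} [Fintype Z] (c : Circuit L X Y) (e : Y ≃ Z) :
    c.comp (ofCospan L (Cospan.ofEquiv e)) ≈ c.reindex id e.symm := by
  refine ⟨⟨Pushout.desc id (fun z => c.out (e.symm z)) fun y => ?_, fun x => Pushout.inl _ _ x,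
    ?_, ?_⟩, Equiv.sumEmpty _ _, ?_, ?_, ?_, ?_, ?_⟩
  · exact congrArg c.out (e.symm_apply_apply y).symm
  · refine Pushout.ind (fun x => rfl) fun z => ?_
    refine (Pushout.glue (f := c.out) (g := (Cospan.ofEquiv e).inp) (e.symm z)).trans ?_
    exact congrArg (Pushout.inr _ _) (e.apply_symm_apply z)
  · intro x; rfl
  · intro x; rfl
  · intro x; rfl
  all_goals rintro (x | x)
  all_goals first | exact isEmptyElim (α := Empty) x | rfl

theorem comp_assoc {X Y Z W : Type} (c : Circuit L X Y) (d : Circuit L Y Z) (k : Circuit L Z W) :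
    (c.comp d).comp k ≈ c.comp (d.comp k) := by
  refine ⟨⟨Pushout.desc (Pushout.desc (fun x => Pushout.inl _ _ x)
      (fun x => Pushout.inr _ _ (Pushout.inl _ _ x)) ?_)
      (fun x => Pushout.inr _ _ (Pushout.inr _ _ x)) ?_,
    Pushout.desc (fun x => Pushout.inl _ _ (Pushout.inl _ _ x))
      (Pushout.desc (fun x => Pushout.inl _ _ (Pushout.inr _ _ x))
      (fun x => Pushout.inr _ _ x) ?_) ?_, ?_, ?_⟩, Equiv.sumAssoc _ _ _, ?_, ?_, ?_, ?_, ?_⟩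
  · exact fun y => Pushout.glue (f := c.out) (g := (d.toCospan.comp k.toCospan).inp) y
  · exact fun z => congrArg (Pushout.inr _ _) (Pushout.glue (f := d.out) (g := k.inp) z)
  · exact fun z => Pushout.glue (f := (c.toCospan.comp d.toCospan).out) (g := k.inp) z
  · exact fun y => congrArg (Pushout.inl _ _) (Pushout.glue (f := c.out) (g := d.inp) y)
  · exact Pushout.ind (Pushout.ind (fun _ => rfl) fun _ => rfl) fun _ => rfl
  · exact Pushout.ind (fun _ => rfl) (Pushout.ind (fun _ => rfl) fun _ => rfl)
  · intro x; rfl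
  · intro x; rfl
  all_goals rintro ((x | x) | x) <;> rfl

theorem tensor_comp {X Y Z X' Y' Z' : Type} (c : Circuit L X Y) (d : Circuit L Y Z)
    (c' : Circuit L X' Y') (d' : Circuit L Y' Z') :
    (c.comp d).tensor (c'.comp d') ≈ (c.tensor c').comp (d.tensor d') := by
  refine ⟨⟨Sum.elim (Pushout.desc (fun x => Pushout.inl _ _ (Sum.inl x))
      (fun x => Pushout.inr _ _ (Sum.inl x)) ?_)
      (Pushout.desc (fun x => Pushout.inl _ _ (Sum.inr x))
      (fun x => Pushout.inr _ _ (Sum.inr x)) ?_),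
    Pushout.desc (Sum.map (Pushout.inl _ _) (Pushout.inl _ _))
      (Sum.map (Pushout.inr _ _) (Pushout.inr _ _)) ?_, ?_, ?_⟩,
      Equiv.sumSumSumComm _ _ _ _, ?_, ?_, ?_, ?_, ?_⟩
  · exact fun y => Pushout.glue (f := (c.tensor c').out) (g := (d.tensor d').inp) (Sum.inl y)
  · exact fun y => Pushout.glue (f := (c.tensor c').out) (g := (d.tensor d').inp) (Sum.inr y)
  · rintro (y | y)
    · exact congrArg Sum.inl (Pushout.glue (f := c.out) (g := d.inp) y)
    · exact congrArg Sum.inr (Pushout.glue (f := c'.out) (g := d'.inp) y)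
  · rintro (x | x)
    · revert x
      exact Pushout.ind (fun _ => rfl) fun _ => rfl
    · revert x
      exact Pushout.ind (fun _ => rfl) fun _ => rfl
  · refine Pushout.ind ?_ ?_ <;> rintro (x | x) <;> rfl
  · rintro (x | x) <;> rfl
  · rintro (x | x) <;> rfl
  all_goals rintro ((x | x) | x | x) <;> rfl

theorem ofEquiv_trans {X Y Z : Type} [Fintype Y] [Fintype Z] (e : X ≃ Y) (e' : Y ≃ Z) :
    (ofCospan L (Cospan.ofEquiv e)).comp (ofCospan L (Cospan.ofEquiv e')) ≈
      ofCospan L (Cospan.ofEquiv (e.trans e')) :=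
  Setoid.trans (ofEquiv_comp _ _) (Setoid.refl _)

theorem tensor_ofEquiv {X Y X' Y' : Type} [Fintype Y] [Fintype Y'] (e : X ≃ Y) (e' : X' ≃ Y') :
    (ofCospan L (Cospan.ofEquiv e)).tensor (ofCospan L (Cospan.ofEquiv e')) ≈
      ofCospan L (Cospan.ofEquiv (Equiv.sumCongr e e')) := by
  refine ⟨Equiv.refl _, Equiv.emptySum _ _, ?_, ?_, ?_, ?_, ?_⟩
  · rintro (x | x) <;> rfl
  · rintro (x | x) <;> rfl
  all_goals rintro (x | x) <;> exact isEmptyElim (α := Empty) x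

theorem assoc_natural {X Y X' Y' X'' Y'' : Type} (c : Circuit L X Y) (d : Circuit L X' Y')
    (k : Circuit L X'' Y'') :
    ((c.tensor d).tensor k).reindex id (Equiv.sumAssoc Y Y' Y'').symm ≈
      (c.tensor (d.tensor k)).reindex (Equiv.sumAssoc X X' X'') id := by
  refine ⟨Equiv.sumAssoc _ _ _, Equiv.sumAssoc _ _ _, ?_, ?_, ?_, ?_, ?_⟩
  · rintro ((x | x) | x) <;> rfl
  · rintro (x | x | x) <;> rfl
  all_goals rintro ((x | x) | x) <;> rfl

theorem unit_natural {X Y : Type} (c : Circuit L X Y) :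
    ((ofCospan L (Cospan.ofEquiv (Equiv.refl (Fin 0)))).tensor c).reindex id
        (Equiv.emptySum (Fin 0) Y).symm ≈ c.reindex (Equiv.emptySum (Fin 0) X) id := by
  refine ⟨Equiv.emptySum (Fin 0) _, Equiv.emptySum _ _, ?_, ?_, ?_, ?_, ?_⟩
  · rintro (x | x)
    · exact x.elim0
    · rfl
  · intro x; rfl
  all_goals rintro (x | x)
  all_goals first | exact isEmptyElim (α := Empty) x | rfl

theorem braid_natural {X Y X' Y' : Type} (c : Circuit L X Y) (d : Circuit L X' Y') :
    (c.tensor d).reindex id (Equiv.sumComm Y Y').symm ≈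
      (d.tensor c).reindex (Equiv.sumComm X X') id := by
  refine ⟨Equiv.sumComm _ _, Equiv.sumComm _ _, ?_, ?_, ?_, ?_, ?_⟩ <;>
    rintro (x | x) <;> rfl

/-- The operations of the category of isomorphism classes of `L`-circuits. -/
def ops (L : Type u) : FinSetOps.{max 1 u} where
  Hom X Y := Quotient (setoid L X Y)
  ofEquiv e := Quotient.mk _ (ofCospan L (Cospan.ofEquiv e))
  comp := Quotient.map₂ comp fun _ _ h _ _ h' => comp_congr h h'
  tensor := Quotient.map₂ tensor fun _ _ h _ _ h' => tensor_congr h h'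

theorem lawful (L : Type u) : (ops L).Lawful where
  id_comp := by
    rintro X Y _ _ ⟨f⟩; exact Quotient.sound (ofEquiv_comp (Equiv.refl X) f)
  comp_id := by
    rintro X Y _ _ ⟨f⟩; exact Quotient.sound (comp_ofEquiv f (Equiv.refl Y))
  assoc := by
    rintro X Y Z W _ _ _ _ ⟨f⟩ ⟨g⟩ ⟨h⟩; exact Quotient.sound (comp_assoc f g h)
  ofEquiv_trans e e' := Quotient.sound (ofEquiv_trans e e')
  tensor_ofEquiv e e' := Quotient.sound (tensor_ofEquiv e e')
  tensor_comp := by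
    rintro X Y Z X' Y' Z' _ _ _ _ _ _ ⟨f⟩ ⟨g⟩ ⟨f'⟩ ⟨g'⟩
    exact Quotient.sound (tensor_comp f g f' g')
  assoc_natural := by
    rintro X Y X' Y' X'' Y'' _ _ _ _ _ _ ⟨f⟩ ⟨g⟩ ⟨h⟩
    exact Quotient.sound (Setoid.trans (comp_ofEquiv _ _)
      (Setoid.trans (assoc_natural f g h) (Setoid.symm (ofEquiv_comp _ _))))
  unit_natural := by
    rintro X Y _ _ ⟨f⟩
    exact Quotient.sound (Setoid.trans (comp_ofEquiv _ _)
      (Setoid.trans (unit_natural f) (Setoid.symm (ofEquiv_comp _ _))))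
  braid_natural := by
    rintro X Y X' Y' _ _ _ _ ⟨f⟩ ⟨g⟩
    exact Quotient.sound (Setoid.trans (comp_ofEquiv _ _)
      (Setoid.trans (braid_natural f g) (Setoid.symm (ofEquiv_comp _ _))))

end Circuit

namespace Cospan

theorem iso_of_circuit {X Y : Type} {c d : Cospan X Y}
    (h : Circuit.ofCospan Empty c ≈ Circuit.ofCospan Empty d) : c ≈ d := by
  obtain ⟨e, _, hi, ho, _⟩ := h
  exact ⟨e, hi, ho⟩

theorem circuit_of_iso (L : Type u) {X Y : Type} {c d : Cospan X Y} (h : c ≈ d) :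
    Circuit.ofCospan L c ≈ Circuit.ofCospan L d := by
  obtain ⟨e, hi, ho⟩ := h
  exact ⟨e, Equiv.refl _, hi, ho, fun x => x.elim, fun x => x.elim, fun x => x.elim⟩

theorem circuit_comp (L : Type u) {X Y Z : Type} (c : Cospan X Y) (d : Cospan Y Z) :
    Circuit.ofCospan L (c.comp d) ≈ (Circuit.ofCospan L c).comp (Circuit.ofCospan L d) :=
  ⟨Equiv.refl _, (Equiv.emptySum Empty Empty).symm, fun _ => rfl, fun _ => rfl, fun x => x.elim,
    fun x => x.elim, fun x => x.elim⟩

theorem circuit_tensor (L : Type u) {X Y X' Y' : Type} (c : Cospan X Y) (d : Cospan X' Y') :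
    Circuit.ofCospan L (c.tensor d) ≈ (Circuit.ofCospan L c).tensor (Circuit.ofCospan L d) :=
  ⟨Equiv.refl _, (Equiv.emptySum Empty Empty).symm, fun _ => rfl, fun _ => rfl, fun x => x.elim,
    fun x => x.elim, fun x => x.elim⟩

theorem iso_of_circuit_iso {L : Type u} {X Y : Type} {c d : Circuit L X Y} (h : c ≈ d) :
    c.toCospan ≈ d.toCospan := by
  obtain ⟨e, _, hi, ho, _⟩ := h
  exact ⟨e, hi, ho⟩

theorem comp_congr {X Y Z : Type} {c c' : Cospan X Y} {d d' : Cospan Y Z} (h : c ≈ c')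
    (h' : d ≈ d') : c.comp d ≈ c'.comp d' :=
  iso_of_circuit_iso (Circuit.comp_congr (circuit_of_iso Empty h) (circuit_of_iso Empty h'))

theorem tensor_congr {X Y X' Y' : Type} {c c' : Cospan X Y} {d d' : Cospan X' Y'} (h : c ≈ c')
    (h' : d ≈ d') : c.tensor d ≈ c'.tensor d' :=
  iso_of_circuit_iso (Circuit.tensor_congr (circuit_of_iso Empty h) (circuit_of_iso Empty h'))

/-- The operations of the category of isomorphism classes of cospans of finite sets. -/
def ops : FinSetOps.{1} where
  Hom X Y := Quotient (setoid X Y)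
  ofEquiv e := Quotient.mk _ (ofEquiv e)
  comp := Quotient.map₂ comp fun _ _ h _ _ h' => comp_congr h h'
  tensor := Quotient.map₂ tensor fun _ _ h _ _ h' => tensor_congr h h'

/-- The underlying cospan of a circuit. -/
def ofCircuitMap (L : Type u) : FinSetOps.Map (Circuit.ops L) ops where
  map := Quotient.map Circuit.toCospan fun _ _ h => iso_of_circuit_iso h
  map_ofEquiv _ := rfl
  map_comp := by rintro X Y Z _ _ _ ⟨f⟩ ⟨g⟩; rfl
  map_tensor := by rintro X Y X' Y' _ _ _ _ ⟨f⟩ ⟨g⟩; rfl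

theorem lawful : ops.Lawful :=
  (ofCircuitMap Empty).lawful
    (by rintro X Y _ _ ⟨f⟩; exact ⟨Quotient.mk _ (Circuit.ofCospan Empty f), rfl⟩)
    (Circuit.lawful Empty)

/-- Cospans as circuits without edges. -/
def toCircuitMap (L : Type u) : FinSetOps.Map ops (Circuit.ops L) where
  map := Quotient.map (Circuit.ofCospan L) fun _ _ h => circuit_of_iso L h
  map_ofEquiv _ := rfl
  map_comp := by rintro X Y Z _ _ _ ⟨f⟩ ⟨g⟩; exact Quotient.sound (circuit_comp L f g)
  map_tensor := by
    rintro X Y X' Y' _ _ _ _ ⟨f⟩ ⟨g⟩; exact Quotient.sound (circuit_tensor L f g)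

end Cospan

/-- The prop `FinCospan`: morphisms `m → n` are isomorphism classes of cospans of finite sets
from `Fin m` to `Fin n`. -/
def FinCospan : PROP.{1} := Cospan.ops.toPROP Cospan.lawful

/-- The prop `Circ_L`: morphisms `m → n` are isomorphism classes of `L`-circuits from `Fin m` to
`Fin n`. -/
def Circ (L : Type u) : PROP.{max 1 u} := (Circuit.ops L).toPROP (Circuit.lawful L)

/-- The inclusion of `FinCospan` in `Circ_L`, as the circuits without edges. -/
def cospanIncl (L : Type u) : PROP.Morphism FinCospan (Circ L) :=
  (Cospan.toCircuitMap L).toMorphism Cospan.lawful (Circuit.lawful L)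

/-- The inclusion of `F(L)` in `Circ_L`, sending each label to the circuit with one edge that has
this label. -/
def labelIncl (L : Type u) : PROP.Morphism (labelProp L) (Circ L) :=
  freeProp.lift (Circ L) fun _ _ s =>
    match s with
    | .label l => Quotient.mk (Circuit.setoid L (Fin 1) (Fin 1)) (Circuit.edge l)

/-! ## Corelations -/

/-- A corelation from `X` to `Y`: a partition of `X ⊕ Y`. -/
def Corel (X Y : Type) : Type := Setoid (X ⊕ Y)

namespace Corel

/-- The partition whose parts are the nonempty fibres of a function. -/
def ofFun {X Y T : Type} (f : X ⊕ Y → T) : Corel X Y := Setoid.ker f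

/-- The parts of a corelation. -/
def Parts {X Y : Type} (R : Corel X Y) : Type := Quotient (show Setoid (X ⊕ Y) from R)

/-- The part that contains a given element. -/
def part {X Y : Type} (R : Corel X Y) (p : X ⊕ Y) : R.Parts := Quotient.mk _ p

theorem part_eq {X Y : Type} (R : Corel X Y) {p q : X ⊕ Y} :
    R.part p = R.part q ↔ Setoid.r (self := R) p q := Quotient.eq (r := R)

theorem ofFun_part {X Y : Type} (R : Corel X Y) : ofFun R.part = R :=
  Setoid.ker_mk_eq R

/-- The finest partition of `X ⊕ Y ⊕ Z` in which elements are in the same part whenever they are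
in the same part of `R` or of `S`. -/
def glue {X Y Z : Type} (R : Corel X Y) (S : Corel Y Z) : Setoid (X ⊕ Y ⊕ Z) :=
  Relation.EqvGen.setoid fun a b =>
    (∃ p q, R.part p = R.part q ∧ a = Sum.map id Sum.inl p ∧ b = Sum.map id Sum.inl q) ∨
    (∃ p q, S.part p = S.part q ∧ a = Sum.inr p ∧ b = Sum.inr q)

/-- Composition of corelations: glue the two partitions along `Y` and restrict to `X ⊕ Z`. -/
def comp {X Y Z : Type} (R : Corel X Y) (S : Corel Y Z) : Corel X Z :=
  Setoid.comap (Sum.map id Sum.inr) (glue R S)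

/-- Disjoint union of corelations. -/
def tensor {X Y X' Y' : Type} (R : Corel X Y) (S : Corel X' Y') : Corel (X ⊕ X') (Y ⊕ Y') :=
  ofFun fun p => Sum.map R.part S.part (Equiv.sumSumSumComm X X' Y Y' p)

/-- A bijection as a corelation: each `x` is in the same part as its image only. -/
def ofEquiv {X Y : Type} (e : X ≃ Y) : Corel X Y := ofFun (Sum.elim e id)

/-- The operations of the category of corelations between finite sets. -/
def ops : FinSetOps.{0} where
  Hom X Y := Corel X Y
  ofEquiv e := ofEquiv e
  comp R S := comp R S
  tensor R S := tensor R S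

/-- The corelation of a cospan `X → N ← Y`: elements of `X ⊕ Y` are in the same part when they
have the same image in `N`. -/
def ofCospan {X Y : Type} (c : Cospan X Y) : Corel X Y := ofFun (Sum.elim c.inp c.out)

theorem ofFun_congr {X Y T T' : Type} {f : X ⊕ Y → T} {f' : X ⊕ Y → T'}
    (h : ∀ p q, f p = f q ↔ f' p = f' q) : ofFun f = ofFun f' :=
  Setoid.ext fun p q => h p q

theorem part_ofFun {X Y T : Type} (f : X ⊕ Y → T) {p q : X ⊕ Y} :
    (ofFun f).part p = (ofFun f).part q ↔ f p = f q := part_eq _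

theorem ofCospan_congr {X Y : Type} {c d : Cospan X Y} (h : c ≈ d) : ofCospan c = ofCospan d := by
  obtain ⟨e, hi, ho⟩ := h
  have he : ∀ p, Sum.elim d.inp d.out p = e (Sum.elim c.inp c.out p) := by
    rintro (p | p)
    exacts [(hi p).symm, (ho p).symm]
  exact ofFun_congr fun p q => by rw [he, he, e.apply_eq_iff_eq]

theorem ofCospan_comp {X Y Z : Type} (c : Cospan X Y) (d : Cospan Y Z) :
    ofCospan (c.comp d) = comp (ofCospan c) (ofCospan d) := by
  apply Setoid.ext
  intro p q
  change Sum.elim (c.comp d).inp (c.comp d).out p = Sum.elim (c.comp d).inp (c.comp d).out q ↔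
    (glue (ofCospan c) (ofCospan d)) (Sum.map id Sum.inr p) (Sum.map id Sum.inr q)
  let G := glue (ofCospan c) (ofCospan d)
  let cl : X ⊕ Y ⊕ Z → Quotient G := Quotient.mk G
  let F : X ⊕ Y ⊕ Z → Pushout c.out d.inp := Sum.elim (fun x => Pushout.inl _ _ (c.inp x))
    fun r => Pushout.inr _ _ (Sum.elim d.inp d.out r)
  have hF : ∀ p : X ⊕ Z, F (Sum.map id Sum.inr p) = Sum.elim (c.comp d).inp (c.comp d).out p := by
    rintro (p | p) <;> rfl
  have hFl : ∀ p : X ⊕ Y, F (Sum.map id Sum.inl p) =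
      Pushout.inl _ _ (Sum.elim c.inp c.out p) := by
    rintro (p | p)
    · rfl
    · exact (Pushout.glue p).symm
  rw [← hF, ← hF]
  constructor
  · intro h
    let a : c.N → Set (Quotient G) := fun n =>
      {t | ∃ r : X ⊕ Y, Sum.elim c.inp c.out r = n ∧ t = cl (Sum.map id Sum.inl r)}
    let b : d.N → Set (Quotient G) := fun n =>
      {t | ∃ r : Y ⊕ Z, Sum.elim d.inp d.out r = n ∧ t = cl (Sum.inr r)}
    have ha : ∀ r, a (Sum.elim c.inp c.out r) = {cl (Sum.map id Sum.inl r)} := by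
      intro r
      ext t
      constructor
      · rintro ⟨r', hr', rfl⟩
        exact Quotient.sound (Relation.EqvGen.rel _ _
          (Or.inl ⟨r', r, (part_ofFun _).2 hr', rfl, rfl⟩))
      · rintro rfl
        exact ⟨r, rfl, rfl⟩
    have hb : ∀ r, b (Sum.elim d.inp d.out r) = {cl (Sum.inr r)} := by
      intro r
      ext t
      constructor
      · rintro ⟨r', hr', rfl⟩
        exact Quotient.sound (Relation.EqvGen.rel _ _
          (Or.inr ⟨r', r, (part_ofFun _).2 hr', rfl, rfl⟩))
      · rintro rfl
        exact ⟨r, rfl, rfl⟩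
    have hab : ∀ y, a (c.out y) = b (d.inp y) := fun y => (ha (Sum.inr y)).trans (hb (Sum.inl y)).symm
    have key : ∀ r, Pushout.desc a b hab (F r) = {cl r} := by
      rintro (r | r)
      · exact ha (Sum.inl r)
      · exact hb r
    have h' := congrArg (Pushout.desc a b hab) h
    rw [key, key] at h'
    exact Quotient.exact (Set.singleton_injective h')
  · intro h
    have : ∀ r s, G r s → F r = F s := by
      intro r s hrs
      induction (show Relation.EqvGen _ r s from hrs) with
      | rel r s h =>
        obtain ⟨p, q, h, rfl, rfl⟩ | ⟨p, q, h, rfl, rfl⟩ := h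
        · rw [hFl, hFl, (part_ofFun _).1 h]
        · exact congrArg (Pushout.inr _ _) ((part_ofFun _).1 h)
      | refl => rfl
      | symm _ _ h ih => exact (ih h).symm
      | trans _ _ _ h₁ h₂ ih₁ ih₂ => exact (ih₁ h₁).trans (ih₂ h₂)
    exact this _ _ h

theorem ofCospan_tensor {X Y X' Y' : Type} (c : Cospan X Y) (d : Cospan X' Y') :
    ofCospan (c.tensor d) = tensor (ofCospan c) (ofCospan d) := by
  have hc := fun p q => part_ofFun (Sum.elim c.inp c.out) (p := p) (q := q)
  have hd := fun p q => part_ofFun (Sum.elim d.inp d.out) (p := p) (q := q)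
  refine ofFun_congr ?_
  rintro ((p | p) | p | p) ((q | q) | q | q) <;>
    simp [Cospan.tensor, ofCospan, hc, hd]

/-- Corelations from cospans, by discarding the elements of the apex that are not in the image of
the feet. -/
def ofCospanMap : FinSetOps.Map Cospan.ops ops where
  map := Quotient.lift ofCospan fun _ _ h => ofCospan_congr h
  map_ofEquiv _ := rfl
  map_comp := by rintro X Y Z _ _ _ ⟨f⟩ ⟨g⟩; exact ofCospan_comp f g
  map_tensor := by rintro X Y X' Y' _ _ _ _ ⟨f⟩ ⟨g⟩; exact ofCospan_tensor f g

theorem lawful : ops.Lawful := by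
  refine ofCospanMap.lawful ?_ Cospan.lawful
  intro X Y _ _ R
  refine ⟨Quotient.mk _ ⟨Parts R, Quotient.finite _, fun x => part R (Sum.inl x),
    fun y => part R (Sum.inr y)⟩, ?_⟩
  refine Eq.trans (ofFun_congr fun p q => ?_) (ofFun_part R)
  rcases p with p | p <;> rcases q with q | q <;> rfl

end Corel

/-- The prop `FinCorel`: morphisms `m → n` are corelations from `Fin m` to `Fin n`. -/
def FinCorel : PROP.{0} := Corel.ops.toPROP Corel.lawful

/-- The morphism `H : FinCospan → FinCorel` that turns a cospan into a corelation. -/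
def cospanToCorel : PROP.Morphism FinCospan FinCorel :=
  Corel.ofCospanMap.toMorphism Cospan.lawful Corel.lawful

/-- The corelation `m → n` with a single part.  For `(m, n) = (2, 1), (0, 1), (1, 2), (1, 0)` these
are the multiplication, unit, comultiplication and counit of the Frobenius monoid `1`. -/
def corelTop (m n : ℕ) : FinCorel.Hom m n := (⊤ : Setoid (Fin m ⊕ Fin n))

/-! ## Lagrangian relations -/

section Lagrangian

variable {k : Type u} [Field k]

/-- A subspace is isotropic if the form vanishes on it. -/
def IsIsotropic {V : Type v} [AddCommGroup V] [Module k V] (ω : LinearMap.BilinForm k V)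
    (S : Submodule k V) : Prop :=
  ∀ v ∈ S, ∀ w ∈ S, ω v w = 0

/-- A subspace is Lagrangian if it is isotropic and not properly contained in any other isotropic
subspace. -/
def IsLagrangian {V : Type v} [AddCommGroup V] [Module k V] (ω : LinearMap.BilinForm k V)
    (S : Submodule k V) : Prop :=
  IsIsotropic ω S ∧ ∀ T, IsIsotropic ω T → S ≤ T → T = S

/-- The symplectic structure on `(k ⊕ k)^X`: the direct sum of copies of the structure
`ω((φ, I), (φ', I')) = φ I' - φ' I` on `k ⊕ k`. -/
def sympForm (k : Type u) [Field k] (X : Type) [Fintype X] :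
    LinearMap.BilinForm k (X → k × k) :=
  LinearMap.mk₂ k (fun u v => ∑ x, ((u x).1 * (v x).2 - (v x).1 * (u x).2))
    (fun a b c => by simp only [Pi.add_apply, Prod.fst_add, Prod.snd_add]
                     rw [← Finset.sum_add_distrib]; exact Finset.sum_congr rfl fun _ _ => by ring)
    (fun t a b => by simp only [Pi.smul_apply, Prod.smul_fst, Prod.smul_snd, smul_eq_mul]
                     rw [Finset.mul_sum]; exact Finset.sum_congr rfl fun _ _ => by ring)
    (fun a b c => by simp only [Pi.add_apply, Prod.fst_add, Prod.snd_add]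
                     rw [← Finset.sum_add_distrib]; exact Finset.sum_congr rfl fun _ _ => by ring)
    (fun t a b => by simp only [Pi.smul_apply, Prod.smul_fst, Prod.smul_snd, smul_eq_mul]
                     rw [Finset.mul_sum]; exact Finset.sum_congr rfl fun _ _ => by ring)

/-- The form on `V ⊕ W` given by the conjugate `-ω` of the form on `V` and the form `ω'` on `W`. -/
def conjSum {V W : Type u} [AddCommGroup V] [Module k V] [AddCommGroup W] [Module k W]
    (ω : LinearMap.BilinForm k V) (ω' : LinearMap.BilinForm k W) :
    LinearMap.BilinForm k (V × W) :=
  (-ω).compl₁₂ (LinearMap.fst k V W) (LinearMap.fst k V W) +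
    ω'.compl₁₂ (LinearMap.snd k V W) (LinearMap.snd k V W)

theorem conjSum_apply {V W : Type u} [AddCommGroup V] [Module k V] [AddCommGroup W] [Module k W]
    (ω : LinearMap.BilinForm k V) (ω' : LinearMap.BilinForm k W) (p q : V × W) :
    conjSum ω ω' p q = -ω p.1 q.1 + ω' p.2 q.2 := rfl

theorem sympForm_apply {X : Type} [Fintype X] (u v : X → k × k) :
    sympForm k X u v = ∑ x, ((u x).1 * (v x).2 - (v x).1 * (u x).2) := rfl

theorem sympForm_isAlt (X : Type) [Fintype X] : (sympForm k X).IsAlt := fun u => by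
  rw [sympForm_apply]; exact Finset.sum_eq_zero fun _ _ => sub_self _

theorem sympForm_sep {k : Type u} [Field k] {X : Type} [Fintype X] {v : X → k × k} (h : ∀ u, sympForm k X u v = 0) :
    v = 0 := by
  classical
  funext x
  have h₁ := h (Pi.single x (1, 0))
  have h₂ := h (Pi.single x (0, 1))
  rw [sympForm_apply, Finset.sum_eq_single x (fun y _ hy => by simp [Pi.single_eq_of_ne hy])
    (by simp)] at h₁ h₂
  simp at h₁ h₂
  exact Prod.ext h₂ h₁

theorem conjSum_isAlt {V W : Type u} [AddCommGroup V] [Module k V] [AddCommGroup W] [Module k W]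
    {ω : LinearMap.BilinForm k V} {ω' : LinearMap.BilinForm k W} (h : ω.IsAlt) (h' : ω'.IsAlt) :
    (conjSum ω ω').IsAlt := fun p => by
  rw [conjSum_apply, h, h']; simp

theorem conjSum_sep {V W : Type u} [AddCommGroup V] [Module k V] [AddCommGroup W] [Module k W]
    {ω : LinearMap.BilinForm k V} {ω' : LinearMap.BilinForm k W}
    (h : ∀ v, (∀ u, ω u v = 0) → v = 0) (h' : ∀ v, (∀ u, ω' u v = 0) → v = 0)
    (q : V × W) (hq : ∀ p, conjSum ω ω' p q = 0) : q = 0 := by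
  refine Prod.ext (h _ fun u => ?_) (h' _ fun u => ?_)
  · simpa [conjSum_apply] using hq (u, 0)
  · simpa [conjSum_apply] using hq (0, u)

theorem isLagrangian_iff {V : Type v} [AddCommGroup V] [Module k V] {ω : LinearMap.BilinForm k V}
    (hω : ω.IsAlt) {S : Submodule k V} : IsLagrangian ω S ↔ ∀ v, (∀ w ∈ S, ω w v = 0) ↔ v ∈ S := by
  constructor
  · rintro ⟨h₁, h₂⟩ v
    refine ⟨fun hv => ?_, fun hv w hw => h₁ w hw v hv⟩
    rw [← h₂ (S ⊔ Submodule.span k {v}) ?_ le_sup_left]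
    · exact Submodule.mem_sup_right (Submodule.mem_span_singleton_self v)
    · intro a ha b hb
      obtain ⟨a', ha', x, hx, rfl⟩ := Submodule.mem_sup.1 ha
      obtain ⟨b', hb', y, hy, rfl⟩ := Submodule.mem_sup.1 hb
      obtain ⟨s, rfl⟩ := Submodule.mem_span_singleton.1 hx
      obtain ⟨t, rfl⟩ := Submodule.mem_span_singleton.1 hy
      have h₃ : ω v b' = 0 := by rw [← hω.neg_eq, hv b' hb', neg_zero]
      simp [h₁ a' ha' b' hb', hv a' ha', h₃, hω v]
  · intro h
    refine ⟨fun v hv w hw => (h w).2 hw v hv, fun T hT hST => le_antisymm (fun v hv => ?_) hST⟩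
    exact (h v).1 fun w hw => hT w (hST hw) v hv

variable (k) in
/-- A Lagrangian relation from `(k ⊕ k)^X` to `(k ⊕ k)^Y`: a Lagrangian subspace of the direct sum
of the conjugate of `(k ⊕ k)^X` and `(k ⊕ k)^Y`. -/
def LagHom (X Y : Type) [Fintype X] [Fintype Y] : Type u :=
  {S : Submodule k ((X → k × k) × (Y → k × k)) //
    IsLagrangian (conjSum (sympForm k X) (sympForm k Y)) S}

namespace LagHom

theorem isAlt (X Y : Type) [Fintype X] [Fintype Y] :
    (conjSum (sympForm k X) (sympForm k Y)).IsAlt :=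
  conjSum_isAlt (sympForm_isAlt X) (sympForm_isAlt Y)

theorem sep (X Y : Type) [Fintype X] [Fintype Y] (q : (X → k × k) × (Y → k × k))
    (hq : ∀ p, conjSum (sympForm k X) (sympForm k Y) p q = 0) : q = 0 :=
  conjSum_sep (fun _ => sympForm_sep) (fun _ => sympForm_sep) q hq

/-- The composite of linear relations. -/
def relComp {U V W : Type u} [AddCommGroup U] [Module k U] [AddCommGroup V] [Module k V]
    [AddCommGroup W] [Module k W] (S : Submodule k (U × V)) (T : Submodule k (V × W)) :
    Submodule k (U × W) where
  carrier := {p | ∃ v, (p.1, v) ∈ S ∧ (v, p.2) ∈ T}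
  zero_mem' := ⟨0, S.zero_mem, T.zero_mem⟩
  add_mem' := by
    rintro p q ⟨v, h₁, h₂⟩ ⟨w, h₃, h₄⟩
    exact ⟨v + w, S.add_mem h₁ h₃, T.add_mem h₂ h₄⟩
  smul_mem' := by
    rintro c p ⟨v, h₁, h₂⟩
    exact ⟨c • v, S.smul_mem c h₁, T.smul_mem c h₂⟩

/-- The relation given by a bijection. -/
def relEquiv (k : Type u) [Field k] {X Y : Type} (e : X ≃ Y) :
    Submodule k ((X → k × k) × (Y → k × k)) where
  carrier := {p | p.1 = p.2 ∘ e}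
  zero_mem' := rfl
  add_mem' := by
    rintro p q (h : p.1 = _) (h' : q.1 = _)
    change p.1 + q.1 = _
    rw [h, h']; rfl
  smul_mem' := by
    rintro c p (h : p.1 = _)
    change c • p.1 = _
    rw [h]; rfl

/-- The direct sum of linear relations. -/
def relSum {X Y X' Y' : Type} (S : Submodule k ((X → k × k) × (Y → k × k)))
    (T : Submodule k ((X' → k × k) × (Y' → k × k))) :
    Submodule k ((X ⊕ X' → k × k) × (Y ⊕ Y' → k × k)) where
  carrier := {p | (p.1 ∘ Sum.inl, p.2 ∘ Sum.inl) ∈ S ∧ (p.1 ∘ Sum.inr, p.2 ∘ Sum.inr) ∈ T}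
  zero_mem' := ⟨S.zero_mem, T.zero_mem⟩
  add_mem' := by
    rintro p q ⟨h₁, h₂⟩ ⟨h₃, h₄⟩
    exact ⟨S.add_mem h₁ h₃, T.add_mem h₂ h₄⟩
  smul_mem' := by
    rintro c p ⟨h₁, h₂⟩
    exact ⟨S.smul_mem c h₁, T.smul_mem c h₂⟩

theorem relComp_isLagrangian {X Y Z : Type} [Fintype X] [Fintype Y] [Fintype Z]
    {S : Submodule k ((X → k × k) × (Y → k × k))} {T : Submodule k ((Y → k × k) × (Z → k × k))}
    (hS : IsLagrangian (conjSum (sympForm k X) (sympForm k Y)) S)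
    (hT : IsLagrangian (conjSum (sympForm k Y) (sympForm k Z)) T) :
    IsLagrangian (conjSum (sympForm k X) (sympForm k Z)) (relComp S T) := by
  rw [isLagrangian_iff (isAlt _ _)] at hS hT ⊢
  rintro ⟨u, w⟩
  constructor
  · intro h
    let B : LinearMap.BilinForm k
        (((X → k × k) × (Y → k × k)) × ((Y → k × k) × (Z → k × k))) :=
      conjSum (-(conjSum (sympForm k X) (sympForm k Y))) (conjSum (sympForm k Y) (sympForm k Z))
    have hB : ∀ p q, B p q = conjSum (sympForm k X) (sympForm k Y) p.1 q.1 +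
        conjSum (sympForm k Y) (sympForm k Z) p.2 q.2 := by
      intro p q; simp [B, conjSum_apply]
    have hAlt : B.IsAlt := fun p => by rw [hB, isAlt, isAlt, add_zero]
    have hnd : B.Nondegenerate := by
      refine (LinearMap.IsRefl.nondegenerate_iff_separatingRight hAlt.isRefl).2 ?_
      intro q hq
      refine Prod.ext (sep _ _ _ fun p => ?_) (sep _ _ _ fun p => ?_)
      · simpa [hB] using hq (p, 0)
      · simpa [hB] using hq (0, p)
    let D : Submodule k (((X → k × k) × (Y → k × k)) × ((Y → k × k) × (Z → k × k))) :=
      LinearMap.range (LinearMap.prod (LinearMap.inr k (X → k × k) (Y → k × k))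
        (LinearMap.inl k (Y → k × k) (Z → k × k)))
    have hD : B.orthogonal (S.prod T ⊔ D) ≤ S.prod T := by
      intro p hp
      rw [LinearMap.BilinForm.mem_orthogonal_iff] at hp
      refine ⟨(hS p.1).1 fun r hr => ?_, (hT p.2).1 fun r hr => ?_⟩
      · simpa [hB] using hp (r, 0) (Submodule.mem_sup_left ⟨hr, T.zero_mem⟩)
      · simpa [hB] using hp (0, r) (Submodule.mem_sup_left ⟨S.zero_mem, hr⟩)
    have hD' : ∀ p ∈ B.orthogonal (S.prod T ⊔ D), p.1.2 = p.2.1 := by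
      intro p hp
      rw [LinearMap.BilinForm.mem_orthogonal_iff] at hp
      refine sub_eq_zero.1 (sympForm_sep fun v => ?_)
      have := hp ((0, v), (v, 0)) (Submodule.mem_sup_right ⟨v, rfl⟩)
      rw [hB, conjSum_apply, conjSum_apply] at this
      simp only [map_zero, LinearMap.zero_apply, neg_zero, zero_add, add_zero] at this
      rw [map_sub, sub_eq_add_neg]
      exact this
    have hmem : ((u, (0 : Y → k × k)), ((0 : Y → k × k), w)) ∈ S.prod T ⊔ D := by
      rw [← LinearMap.BilinForm.orthogonal_orthogonal hnd hAlt.isRefl (S.prod T ⊔ D),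
        LinearMap.BilinForm.mem_orthogonal_iff]
      intro p hp
      have h₁ := hD hp
      have h₂ := hD' p hp
      have := h (p.1.1, p.2.2) ⟨p.1.2, h₁.1, by rw [h₂]; exact h₁.2⟩
      rw [hB, conjSum_apply, conjSum_apply]
      rw [conjSum_apply] at this
      simpa using this
    obtain ⟨p, hp, q, ⟨v, rfl⟩, hpq⟩ := Submodule.mem_sup.1 hmem
    obtain ⟨⟨a, b⟩, ⟨c, d⟩⟩ := p
    have ha : a + 0 = u := congrArg (fun r => r.1.1) hpq
    have hb : b + v = 0 := congrArg (fun r => r.1.2) hpq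
    have hc : c + v = 0 := congrArg (fun r => r.2.1) hpq
    have hd : d + 0 = w := congrArg (fun r => r.2.2) hpq
    rw [add_zero] at ha hd
    subst ha hd
    have hbc : b = c := add_right_cancel (hb.trans hc.symm)
    subst hbc
    exact ⟨b, hp.1, hp.2⟩
  · rintro ⟨v, h₁, h₂⟩ ⟨u', w'⟩ ⟨v', h₁', h₂'⟩
    have e₁ := (hS _).2 h₁ _ h₁'
    have e₂ := (hT _).2 h₂ _ h₂'
    simp only [conjSum_apply] at e₁ e₂ ⊢
    linear_combination e₁ + e₂

theorem relEquiv_isLagrangian {X Y : Type} [Fintype X] [Fintype Y] (e : X ≃ Y) :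
    IsLagrangian (conjSum (sympForm k X) (sympForm k Y)) (relEquiv k e) := by
  have he : ∀ (v : Y → k × k) (u : X → k × k),
      sympForm k X (v ∘ e) u = sympForm k Y v (u ∘ e.symm) := by
    intro v u
    rw [sympForm_apply, sympForm_apply, ← e.sum_comp]
    simp
  rw [isLagrangian_iff (isAlt _ _)]
  rintro ⟨u, w⟩
  constructor
  · intro h
    have : w - u ∘ e.symm = 0 := sympForm_sep fun v => by
      have := h (v ∘ e, v) rfl
      rw [conjSum_apply, he] at this
      rw [map_sub, sub_eq_add_neg, add_comm]
      exact this
    rw [sub_eq_zero] at this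
    change u = w ∘ e
    rw [this]
    funext x
    simp
  · rintro (h : u = w ∘ e) ⟨u', w'⟩ (h' : u' = w' ∘ e)
    subst h h'
    rw [conjSum_apply, he]
    have : (w ∘ e) ∘ e.symm = w := by funext x; simp
    rw [this, neg_add_cancel]

theorem relSum_isLagrangian {X Y X' Y' : Type} [Fintype X] [Fintype Y] [Fintype X'] [Fintype Y']
    {S : Submodule k ((X → k × k) × (Y → k × k))} {T : Submodule k ((X' → k × k) × (Y' → k × k))}
    (hS : IsLagrangian (conjSum (sympForm k X) (sympForm k Y)) S)
    (hT : IsLagrangian (conjSum (sympForm k X') (sympForm k Y')) T) :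
    IsLagrangian (conjSum (sympForm k (X ⊕ X')) (sympForm k (Y ⊕ Y'))) (relSum S T) := by
  have hsum : ∀ p q : (X ⊕ X' → k × k) × (Y ⊕ Y' → k × k),
      conjSum (sympForm k (X ⊕ X')) (sympForm k (Y ⊕ Y')) p q =
      conjSum (sympForm k X) (sympForm k Y) (p.1 ∘ Sum.inl, p.2 ∘ Sum.inl)
        (q.1 ∘ Sum.inl, q.2 ∘ Sum.inl) +
      conjSum (sympForm k X') (sympForm k Y') (p.1 ∘ Sum.inr, p.2 ∘ Sum.inr)
        (q.1 ∘ Sum.inr, q.2 ∘ Sum.inr) := by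
    intro p q
    simp only [conjSum_apply, sympForm_apply, Fintype.sum_sum_type, Function.comp_apply]
    ring
  rw [isLagrangian_iff (isAlt _ _)] at hS hT ⊢
  intro p
  constructor
  · intro h
    refine ⟨(hS _).1 fun r hr => ?_, (hT _).1 fun r hr => ?_⟩
    · have := h (Sum.elim r.1 0, Sum.elim r.2 0) ⟨hr, T.zero_mem⟩
      rw [hsum] at this
      simpa [conjSum_apply] using this
    · have := h (Sum.elim 0 r.1, Sum.elim 0 r.2) ⟨S.zero_mem, hr⟩
      rw [hsum] at this
      simpa [conjSum_apply] using this
  · rintro ⟨h₁, h₂⟩ q ⟨h₃, h₄⟩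
    rw [hsum, (hS _).2 h₁ _ h₃, (hT _).2 h₂ _ h₄, add_zero]

variable (k) in
/-- The operations of the category of Lagrangian relations between the spaces `(k ⊕ k)^X`. -/
def ops : FinSetOps.{u} where
  Hom X Y := LagHom k X Y
  ofEquiv e := ⟨relEquiv k e, relEquiv_isLagrangian e⟩
  comp S T := ⟨relComp S.1 T.1, relComp_isLagrangian S.2 T.2⟩
  tensor S T := ⟨relSum S.1 T.1, relSum_isLagrangian S.2 T.2⟩

theorem ext' {X Y : Type} [Fintype X] [Fintype Y] {S T : LagHom k X Y}
    (h : ∀ u v, (u, v) ∈ S.1 ↔ (u, v) ∈ T.1) : S = T :=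
  Subtype.ext (Submodule.ext fun p => h p.1 p.2)

theorem mem_ofEquiv_comp {X Y Z : Type} [Fintype X] [Fintype Y] [Fintype Z] (e : X ≃ Y)
    (S : LagHom k Y Z) (u : X → k × k) (w : Z → k × k) :
    (u, w) ∈ ((ops k).comp ((ops k).ofEquiv e) S : LagHom k X Z).1 ↔
      (u ∘ e.symm, w) ∈ S.1 := by
  constructor
  · rintro ⟨v, h, h'⟩
    obtain rfl : u = v ∘ e := h
    have : (v ∘ e) ∘ e.symm = v := by funext x; simp
    rw [this]; exact h'
  · intro h
    refine ⟨_, ?_, h⟩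
    change u = (u ∘ e.symm) ∘ e
    funext x; simp

theorem mem_comp_ofEquiv {X Y Z : Type} [Fintype X] [Fintype Y] [Fintype Z]
    (S : LagHom k X Y) (e : Y ≃ Z) (u : X → k × k) (w : Z → k × k) :
    (u, w) ∈ ((ops k).comp S ((ops k).ofEquiv e) : LagHom k X Z).1 ↔ (u, w ∘ e) ∈ S.1 := by
  constructor
  · rintro ⟨v, h, h'⟩
    obtain rfl : v = w ∘ e := h'
    exact h
  · intro h
    exact ⟨_, h, rfl⟩

variable (k) in
theorem lawful : (ops k).Lawful where
  id_comp f := ext' fun u v => mem_ofEquiv_comp _ _ _ _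
  comp_id f := ext' fun u v => mem_comp_ofEquiv _ _ _ _
  assoc f g h := by
    refine ext' fun u v => ⟨?_, ?_⟩
    · rintro ⟨b, ⟨a, h₁, h₂⟩, h₃⟩
      exact ⟨a, h₁, b, h₂, h₃⟩
    · rintro ⟨a, h₁, b, h₂, h₃⟩
      exact ⟨b, ⟨a, h₁, h₂⟩, h₃⟩
  ofEquiv_trans e e' := ext' fun u v => mem_comp_ofEquiv _ _ _ _
  tensor_ofEquiv e e' := by
    refine ext' fun u v => ⟨?_, ?_⟩
    · rintro ⟨h₁, h₂⟩
      change u = _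
      funext x
      rcases x with x | x
      exacts [congrFun h₁ x, congrFun h₂ x]
    · intro h
      obtain rfl : u = v ∘ Equiv.sumCongr e e' := h
      exact ⟨rfl, rfl⟩
  tensor_comp f g f' g' := by
    refine ext' fun u v => ⟨?_, ?_⟩
    · rintro ⟨⟨a, h₁, h₂⟩, b, h₃, h₄⟩
      exact ⟨Sum.elim a b, ⟨h₁, h₃⟩, h₂, h₄⟩
    · rintro ⟨a, ⟨h₁, h₃⟩, h₂, h₄⟩
      exact ⟨⟨_, h₁, h₂⟩, _, h₃, h₄⟩
  assoc_natural f g h := by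
    refine ext' fun u v => (mem_comp_ofEquiv _ _ _ _).trans
      (Iff.trans ?_ (mem_ofEquiv_comp _ _ _ _).symm)
    exact and_assoc
  unit_natural f := by
    refine ext' fun u v => (mem_comp_ofEquiv _ _ _ _).trans
      (Iff.trans ?_ (mem_ofEquiv_comp _ _ _ _).symm)
    exact and_iff_right (funext fun x => x.elim0)
  braid_natural f g := by
    refine ext' fun u v => (mem_comp_ofEquiv _ _ _ _).trans
      (Iff.trans ?_ (mem_ofEquiv_comp _ _ _ _).symm)
    exact and_comm

end LagHom

variable (k) in
/-- The prop `LagRel_k`: morphisms `m → n` are linear Lagrangian relations from `(k ⊕ k)^m` to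
`(k ⊕ k)^n`. -/
def LagRel : PROP.{u} := (LagHom.ops k).toPROP (LagHom.lawful k)

end Lagrangian

/-- The Lagrangian subspace underlying a morphism of `LagRel_k`. -/
def LagRel.rel {k : Type u} [Field k] {m n : ℕ} (f : (LagRel k).Hom m n) :
    Submodule k ((Fin m → k × k) × (Fin n → k × k)) :=
  Subtype.val (show LagHom k (Fin m) (Fin n) from f)

/-- `K : FinCorel → LagRel_k` sends the Frobenius monoid `1` of `FinCorel` to `k ⊕ k`, where the
first copy of `k` (the potentials) has the duplicative Frobenius structure and the second copy
(the currents) has the additive one.  The four conditions are about the multiplication, the unit,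
the comultiplication and the counit. -/
def SendsFrobenius {k : Type u} [Field k] (K : PROP.Morphism FinCorel (LagRel k)) : Prop :=
  (∀ (u : Fin 2 → k × k) (v : Fin 1 → k × k), (u, v) ∈ LagRel.rel (K.map (corelTop 2 1)) ↔
    (u 0).1 = (v 0).1 ∧ (u 1).1 = (v 0).1 ∧ (u 0).2 + (u 1).2 = (v 0).2) ∧
  (∀ (u : Fin 0 → k × k) (v : Fin 1 → k × k), (u, v) ∈ LagRel.rel (K.map (corelTop 0 1)) ↔
    (v 0).2 = 0) ∧
  (∀ (u : Fin 1 → k × k) (v : Fin 2 → k × k), (u, v) ∈ LagRel.rel (K.map (corelTop 1 2)) ↔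
    (u 0).1 = (v 0).1 ∧ (u 0).1 = (v 1).1 ∧ (u 0).2 = (v 0).2 + (v 1).2) ∧
  (∀ (u : Fin 1 → k × k) (v : Fin 0 → k × k), (u, v) ∈ LagRel.rel (K.map (corelTop 1 0)) ↔
    (u 0).2 = 0)

/-!
Every function between finite sets `φ` gives two cospans, `φ` forwards and `φ` backwards. Every
cospan is a forward function followed by a backward one, and every function is built from the
multiplication `2 → 1` and the unit `0 → 1`; since corelations are images of cospans, this
determines `K` by the four values prescribed. To construct `K`, send a corelation `R` to the
relation saying that the potentials are constant on the parts of `R` and that the currents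
annihilate all such potentials; this is `C ⊕ C^⊥` for a space `C` of potentials, hence Lagrangian.
Composition amounts to the fact that a current annihilating the potentials of a composite extends
to one in the middle that is annihilated on both sides.

A circuit is the forward function of its inputs, followed by the endomorphisms that attach its
edges one at a time, followed by the backward function of its outputs. In any prop receiving a
morphism from `FinCospan`, the operations that attach an edge commute with each other and slide
along forward and backward functions, so a value for each label determines a value for each
circuit, compatibly with composition and tensor product.
-/

local infixr:80 " ≫ " => PROP.comp _

local infixr:90 " ⊗ " => PROP.tensor _

/-! ## Pushout squares -/

/-- The commutative square of sets with sides `f : Y → A`, `g : Y → B`, `a : A → T` and `b : B → T`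
is a pushout. -/
def IsPushoutSquare {Y A B T : Type} (f : Y → A) (g : Y → B) (a : A → T) (b : B → T) : Prop :=
  ∃ h : ∀ y, a (f y) = b (g y), Function.Bijective (Pushout.desc a b h)

namespace IsPushoutSquare

variable {Y A B T : Type} {f : Y → A} {g : Y → B} {a : A → T} {b : B → T}

theorem of_retraction (h : ∀ y, a (f y) = b (g y)) (r : T → Pushout f g)
    (hl : ∀ x, r (a x) = Pushout.inl f g x) (hr : ∀ x, r (b x) = Pushout.inr f g x)
    (hs : ∀ t, Pushout.desc a b h (r t) = t) : IsPushoutSquare f g a b :=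
  ⟨h, Function.bijective_iff_has_inverse.2 ⟨r, Pushout.ind hl hr, hs⟩⟩

theorem inl_inr (f : Y → A) (g : Y → B) :
    IsPushoutSquare f g (Pushout.inl f g) (Pushout.inr f g) :=
  of_retraction Pushout.glue id (fun _ => rfl) (fun _ => rfl)
    (Pushout.ind (fun _ => rfl) fun _ => rfl)

theorem symm (H : IsPushoutSquare f g a b) : IsPushoutSquare g f b a := by
  obtain ⟨h, hbij⟩ := H
  let e := Equiv.ofBijective _ hbij
  let swap : Pushout f g → Pushout g f :=
    Pushout.desc (Pushout.inr g f) (Pushout.inl g f) fun y => (Pushout.glue y).symm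
  have desc_swap (p : Pushout f g) : Pushout.desc b a (fun y => (h y).symm) (swap p) = e p :=
    Pushout.ind (motive := fun p => Pushout.desc b a _ (swap p) = e p) (fun _ => rfl)
      (fun _ => rfl) p
  refine of_retraction (fun y => (h y).symm) (swap ∘ e.symm) (fun x => ?_) (fun x => ?_)
    fun t => (desc_swap _).trans (e.apply_symm_apply t)
  · exact congrArg swap (e.symm_apply_apply (Pushout.inr f g x))
  · exact congrArg swap (e.symm_apply_apply (Pushout.inl f g x))

theorem equiv_right (f : Y → A) (e : Y ≃ B) : IsPushoutSquare f e id (f ∘ e.symm) :=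
  of_retraction (fun y => by simp) (Pushout.inl f e) (fun _ => rfl)
    (fun x => by simpa using Pushout.glue (f := f) (g := e) (e.symm x)) fun _ => rfl

theorem id_right (f : Y → A) : IsPushoutSquare f id id f :=
  equiv_right f (Equiv.refl Y)

theorem id_left (g : Y → B) : IsPushoutSquare id g g id :=
  (id_right g).symm

theorem inr_sumMap {X : Type} (g : Y → B) :
    IsPushoutSquare (Sum.inr : Y → X ⊕ Y) g (Sum.map id g) Sum.inr :=
  of_retraction (fun _ => rfl) (Sum.elim (Pushout.inl _ g ∘ Sum.inl) (Pushout.inr _ g))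
    (Sum.rec (fun _ => rfl) fun y => (Pushout.glue y).symm) (fun _ => rfl)
    (Sum.rec (fun _ => rfl) fun _ => rfl)

theorem comp_equiv {T' : Type} (H : IsPushoutSquare f g a b) (e : T ≃ T') :
    IsPushoutSquare f g (e ∘ a) (e ∘ b) := by
  obtain ⟨h, hbij⟩ := H
  refine ⟨fun y => congrArg e (h y), ?_⟩
  have desc_comp : Pushout.desc (e ∘ a) (e ∘ b) (fun y => congrArg e (h y)) =
      e ∘ Pushout.desc a b h :=
    funext (Pushout.ind (fun _ => rfl) fun _ => rfl)
  exact desc_comp ▸ e.bijective.comp hbij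

theorem exists_fin [Finite A] [Finite B] (f : Y → A) (g : Y → B) :
    ∃ (r : ℕ) (a : A → Fin r) (b : B → Fin r), IsPushoutSquare f g a b :=
  let ⟨r, ⟨e⟩⟩ := Finite.exists_equiv_fin (Pushout f g)
  ⟨r, _, _, (inl_inr f g).comp_equiv e⟩

end IsPushoutSquare

theorem Cospan.comp_equiv_of_isPushoutSquare {X Y Z : Type} {c : Cospan X Y} {d : Cospan Y Z}
    {k : Cospan X Z} {a : c.N → k.N} {b : d.N → k.N} (H : IsPushoutSquare c.out d.inp a b)
    (hinp : ∀ x, a (c.inp x) = k.inp x) (hout : ∀ z, b (d.out z) = k.out z) : c.comp d ≈ k :=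
  let ⟨_, hbij⟩ := H
  ⟨Equiv.ofBijective _ hbij, hinp, hout⟩

/-! ## Functions between standard finite sets -/

/-- The disjoint union `φ + ψ` of two functions between standard finite sets. -/
def finSumMap {m n m' n' : ℕ} (φ : Fin m → Fin n) (ψ : Fin m' → Fin n') :
    Fin (m + m') → Fin (n + n') :=
  finSumFinEquiv ∘ Sum.map φ ψ ∘ finSumFinEquiv.symm

section FinFunctions

variable {m n m' n' : ℕ}

@[simp] theorem finSumMap_castAdd (φ : Fin m → Fin n) (ψ : Fin m' → Fin n') (x : Fin m) :
    finSumMap φ ψ (Fin.castAdd m' x) = Fin.castAdd n' (φ x) := by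
  simp [finSumMap]

@[simp] theorem finSumMap_natAdd (φ : Fin m → Fin n) (ψ : Fin m' → Fin n') (x : Fin m') :
    finSumMap φ ψ (Fin.natAdd m x) = Fin.natAdd n (ψ x) := by
  simp [finSumMap]

theorem comp_append {S T : Type} (φ : S → T) (a : Fin m → S) (b : Fin n → S) :
    φ ∘ Fin.append a b = Fin.append (φ ∘ a) (φ ∘ b) := by
  funext x
  refine Fin.addCases (fun x => ?_) (fun x => ?_) x <;> simp

theorem append_comp_finSumMap {T : Type} (a : Fin n → T) (b : Fin n' → T) (φ : Fin m → Fin n)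
    (ψ : Fin m' → Fin n') : Fin.append a b ∘ finSumMap φ ψ = Fin.append (a ∘ φ) (b ∘ ψ) := by
  funext x
  refine Fin.addCases (fun x => ?_) (fun x => ?_) x <;> simp

@[simp] theorem append_castSucc {T : Type} (a : Fin n → T) (b : Fin 1 → T) (x : Fin n) :
    Fin.append a b x.castSucc = a x :=
  Fin.append_left a b x

@[simp] theorem append_last {T : Type} (a : Fin n → T) (b : Fin 1 → T) :
    Fin.append a b (Fin.last n) = b 0 :=
  Fin.append_right a b 0

@[simp] theorem finSumMap_castSucc (φ : Fin m → Fin n) (ψ : Fin 1 → Fin 1) (x : Fin m) :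
    finSumMap φ ψ x.castSucc = (φ x).castSucc :=
  finSumMap_castAdd φ ψ x

@[simp] theorem finSumMap_last (φ : Fin m → Fin n) (ψ : Fin 1 → Fin 1) :
    finSumMap φ ψ (Fin.last m) = Fin.last n :=
  (finSumMap_natAdd φ ψ 0).trans (congrArg (Fin.natAdd n) (Subsingleton.elim (ψ 0) 0))

theorem finSumMap_id_two_eq_iff {T : Type} {p : ℕ} {ψ : Fin 2 → Fin p} {α : Fin (n + p) → T}
    {φ : Fin (n + 2) → T} : α ∘ finSumMap id ψ = φ ↔
      (∀ x : Fin n, α (Fin.castAdd p x) = φ x.castSucc.castSucc) ∧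
        α (Fin.natAdd n (ψ 0)) = φ (Fin.last n).castSucc ∧
        α (Fin.natAdd n (ψ 1)) = φ (Fin.last (n + 1)) := by
  have h (x : Fin n) : finSumMap id ψ x.castSucc.castSucc = Fin.castAdd p x :=
    finSumMap_castAdd id ψ x
  have h₀ : finSumMap (id : Fin n → Fin n) ψ (Fin.last n).castSucc = Fin.natAdd n (ψ 0) :=
    finSumMap_natAdd id ψ 0
  have h₁ : finSumMap (id : Fin n → Fin n) ψ (Fin.last (n + 1)) = Fin.natAdd n (ψ 1) :=
    finSumMap_natAdd id ψ 1
  rw [funext_iff, Fin.forall_fin_succ', Fin.forall_fin_succ']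
  simp only [Function.comp_apply, h, h₀, h₁, and_assoc]

theorem finSumMap_id_mul_eq_append (n : ℕ) :
    finSumMap (id : Fin n → Fin n) (fun _ : Fin 2 => (0 : Fin 1)) =
      Fin.append id fun _ : Fin 1 => Fin.last n :=
  finSumMap_id_two_eq_iff (α := id).2
    ⟨fun _ => (append_castSucc _ _ _).symm, (append_castSucc _ _ _).symm,
      (append_last id fun _ => Fin.last n).symm⟩

theorem finSumMap_append_comp_flip_eq_append (t : Fin n) :
    finSumMap (Fin.append id fun _ : Fin 1 => t) (id : Fin 1 → Fin 1) ∘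
        finSumMap (m' := 1 + 1) (n' := 1 + 1) (id : Fin n → Fin n) finAddFlip =
      Fin.append id fun _ : Fin 1 => t.castSucc :=
  finSumMap_id_two_eq_iff.2
    ⟨fun x => (finSumMap_castSucc _ _ x.castSucc).trans (by simp),
      (finSumMap_last _ _).trans (append_castSucc id _ (Fin.last n)).symm,
      (finSumMap_castSucc _ _ (Fin.last n)).trans (by simp)⟩

theorem isPushoutSquare_append_id (σ : Fin m → Fin n) (φ : Fin n → Fin n') :
    IsPushoutSquare (Fin.append σ id) (finSumMap id φ) φ (Fin.append (φ ∘ σ) id) := by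
  have glue (x : Fin n) : Pushout.inr (Fin.append σ id) (finSumMap id φ) (Fin.natAdd m (φ x)) =
      Pushout.inl (Fin.append σ id) (finSumMap id φ) x := by
    simpa using (Pushout.glue (f := Fin.append σ id) (g := finSumMap id φ) (Fin.natAdd m x)).symm
  refine .of_retraction ?_ (fun y => Pushout.inr _ _ (Fin.natAdd m y)) glue ?_ ?_
  · exact fun y => Fin.addCases (by simp) (by simp) y
  · refine fun y => Fin.addCases (fun i => ?_) (fun y => by simp) y
    have h := Pushout.glue (f := Fin.append σ id) (g := finSumMap id φ) (Fin.castAdd n i)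
    simpa [glue] using h
  · simp

theorem isPushoutSquare_elim0 (m n : ℕ) :
    IsPushoutSquare (Fin.elim0 : Fin 0 → Fin m) (Fin.elim0 : Fin 0 → Fin n) (Fin.castAdd n)
      (Fin.natAdd m) :=
  .of_retraction (fun y => y.elim0) (Fin.append (Pushout.inl _ _) (Pushout.inr _ _)) (by simp)
    (by simp) (Fin.addCases (by simp) (by simp))

end FinFunctions

/-- The functions between standard finite sets obtained from the multiplication `2 → 1` and the
unit `0 → 1` of the commutative monoid `1` by the operations of a prop. -/
inductive MonoidGenerated : ∀ {m n : ℕ}, (Fin m → Fin n) → Prop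
  | id_fun (n : ℕ) : MonoidGenerated (id : Fin n → Fin n)
  | comp {m n p : ℕ} {φ : Fin m → Fin n} {ψ : Fin n → Fin p} :
      MonoidGenerated φ → MonoidGenerated ψ → MonoidGenerated (ψ ∘ φ)
  | sumMap {m n m' n' : ℕ} {φ : Fin m → Fin n} {ψ : Fin m' → Fin n'} :
      MonoidGenerated φ → MonoidGenerated ψ → MonoidGenerated (finSumMap φ ψ)
  | flip (m n : ℕ) : MonoidGenerated (finAddFlip (m := m) (n := n))
  | mul : MonoidGenerated (fun _ : Fin 2 => (0 : Fin 1))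
  | unit : MonoidGenerated (Fin.elim0 : Fin 0 → Fin 1)

namespace MonoidGenerated

theorem append_id_const : ∀ {n : ℕ} (t : Fin n),
    MonoidGenerated (Fin.append id fun _ : Fin 1 => t)
  | n + 1, t => by
    induction t using Fin.lastCases with
    | last => exact finSumMap_id_mul_eq_append n ▸ (id_fun n).sumMap mul
    | cast t =>
      exact finSumMap_append_comp_flip_eq_append t ▸
        ((id_fun n).sumMap (flip 1 1)).comp ((append_id_const t).sumMap (id_fun 1))

theorem of_isEmpty : ∀ {n : ℕ} (φ : Fin 0 → Fin n), MonoidGenerated φ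
  | 0, φ => Subsingleton.elim id φ ▸ id_fun 0
  | n + 1, φ => by
    rw [Subsingleton.elim φ (finSumMap Fin.elim0 Fin.elim0)]
    exact (of_isEmpty (Fin.elim0 : Fin 0 → Fin n)).sumMap unit

theorem of_function : ∀ {m n : ℕ} (φ : Fin m → Fin n), MonoidGenerated φ
  | 0, _, φ => of_isEmpty φ
  | m + 1, n, φ => by
    have h := ((of_function (φ ∘ Fin.castAdd 1)).sumMap (id_fun 1)).comp
      (append_id_const (φ (Fin.natAdd m 0)))
    rw [append_comp_finSumMap] at h
    convert h using 1
    funext x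
    refine Fin.addCases (fun x => ?_) (fun x => ?_) x
    · simp
    · simp [Subsingleton.elim x 0]

end MonoidGenerated

/-! ## Generators of `FinCospan` and `FinCorel` -/

namespace FinCospan

/-- The morphism of `FinCospan` represented by a cospan. -/
def mk {m n : ℕ} (c : Cospan (Fin m) (Fin n)) : FinCospan.Hom m n :=
  Quotient.mk (Cospan.setoid (Fin m) (Fin n)) c

/-- The covariant embedding of functions in `FinCospan`: the cospan of `φ` and an identity. -/
def fwd {m n : ℕ} (φ : Fin m → Fin n) : FinCospan.Hom m n := mk ⟨Fin n, inferInstance, φ, id⟩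

/-- The contravariant embedding of functions in `FinCospan`: the cospan of an identity and `φ`. -/
def bwd {m n : ℕ} (φ : Fin m → Fin n) : FinCospan.Hom n m := mk ⟨Fin n, inferInstance, id, φ⟩

section

variable {m n p q m' n' : ℕ}

theorem fwd_id (n : ℕ) : fwd (id : Fin n → Fin n) = FinCospan.id n := rfl

theorem bwd_id (n : ℕ) : bwd (id : Fin n → Fin n) = FinCospan.id n := rfl

theorem mk_comp_mk {N M T : Type} [Finite N] [Finite M] [Finite T] {inp : Fin m → N}
    {out : Fin n → N} {inp' : Fin n → M} {out' : Fin p → M} {a : N → T} {b : M → T}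
    (H : IsPushoutSquare out inp' a b) :
    mk ⟨N, inferInstance, inp, out⟩ ≫ mk ⟨M, inferInstance, inp', out'⟩ =
      mk ⟨T, inferInstance, a ∘ inp, b ∘ out'⟩ :=
  Quotient.sound (Cospan.comp_equiv_of_isPushoutSquare H (fun _ => rfl) fun _ => rfl)

theorem fwd_comp_fwd (φ : Fin m → Fin n) (ψ : Fin n → Fin p) : fwd φ ≫ fwd ψ = fwd (ψ ∘ φ) :=
  mk_comp_mk (.id_left ψ)

theorem bwd_comp_bwd (φ : Fin m → Fin n) (ψ : Fin n → Fin p) : bwd ψ ≫ bwd φ = bwd (ψ ∘ φ) :=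
  mk_comp_mk (.id_right ψ)

theorem fwd_comp_bwd (φ : Fin m → Fin q) (ψ : Fin n → Fin q) :
    fwd φ ≫ bwd ψ = mk ⟨Fin q, inferInstance, φ, ψ⟩ :=
  mk_comp_mk (.id_left id)

theorem bwd_comp_fwd {φ : Fin m → Fin n} {ψ : Fin m → Fin p} {a : Fin n → Fin q}
    {b : Fin p → Fin q} (H : IsPushoutSquare φ ψ a b) : bwd φ ≫ fwd ψ = fwd a ≫ bwd b :=
  (mk_comp_mk H).trans (fwd_comp_bwd a b).symm

theorem bwd_equiv (e : Fin m ≃ Fin n) : bwd e = fwd e.symm :=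
  Quotient.sound ⟨e.symm, fun _ => rfl, e.symm_apply_apply⟩

theorem fwd_equiv_comp_bwd (e : Fin m ≃ Fin n) : fwd e ≫ bwd e = FinCospan.id m := by
  rw [bwd_equiv, fwd_comp_fwd, e.symm_comp_self, fwd_id]

theorem mk_tensor_mk (c : Cospan (Fin m) (Fin n)) (d : Cospan (Fin m') (Fin n')) :
    mk c ⊗ mk d = mk ⟨c.N ⊕ d.N, inferInstance, Sum.map c.inp d.inp ∘ finSumFinEquiv.symm,
      Sum.map c.out d.out ∘ finSumFinEquiv.symm⟩ :=
  have reindex_inp (k : Cospan (Fin m ⊕ Fin m') (Fin (n + n'))) :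
      (Cospan.ofEquiv finSumFinEquiv.symm).comp k ≈
        ⟨k.N, inferInstance, k.inp ∘ finSumFinEquiv.symm, k.out⟩ :=
    Cospan.comp_equiv_of_isPushoutSquare (.id_left k.inp) (fun _ => rfl) fun _ => rfl
  have reindex_out (k : Cospan (Fin m ⊕ Fin m') (Fin n ⊕ Fin n')) :
      k.comp (Cospan.ofEquiv finSumFinEquiv) ≈
        ⟨k.N, inferInstance, k.inp, k.out ∘ finSumFinEquiv.symm⟩ :=
    Cospan.comp_equiv_of_isPushoutSquare (.equiv_right k.out _) (fun _ => rfl) fun _ => rfl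
  Quotient.sound (Setoid.trans (Cospan.comp_congr (Setoid.refl _) (reindex_out (c.tensor d)))
    (reindex_inp _))

theorem fwd_tensor_fwd (φ : Fin m → Fin n) (ψ : Fin m' → Fin n') :
    fwd φ ⊗ fwd ψ = fwd (finSumMap φ ψ) :=
  (mk_tensor_mk _ _).trans (Quotient.sound ⟨finSumFinEquiv, fun _ => rfl, fun x => by simp⟩)

theorem bwd_tensor_bwd (φ : Fin m → Fin n) (ψ : Fin m' → Fin n') :
    bwd φ ⊗ bwd ψ = bwd (finSumMap φ ψ) :=
  (mk_tensor_mk _ _).trans (Quotient.sound ⟨finSumFinEquiv, fun x => by simp, fun _ => rfl⟩)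

theorem exists_eq_fwd_comp_bwd (x : FinCospan.Hom m n) :
    ∃ (q : ℕ) (φ : Fin m → Fin q) (ψ : Fin n → Fin q), x = fwd φ ≫ bwd ψ := by
  obtain ⟨c⟩ := x
  obtain ⟨q, ⟨e⟩⟩ := Finite.exists_equiv_fin c.N
  have equiv : mk c = mk ⟨Fin q, inferInstance, e ∘ c.inp, e ∘ c.out⟩ :=
    Quotient.sound ⟨e, fun _ => rfl, fun _ => rfl⟩
  exact ⟨q, e ∘ c.inp, e ∘ c.out, equiv.trans (fwd_comp_bwd _ _).symm⟩

end

section Generators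

variable {T : PROP.{w}} {f f' : PROP.Morphism FinCospan T} {m n : ℕ}

/-- Two morphisms of props from `FinCospan` agree on both embeddings of a function. -/
def AgreeOn (f f' : PROP.Morphism FinCospan T) (φ : Fin m → Fin n) : Prop :=
  f.map (fwd φ) = f'.map (fwd φ) ∧ f.map (bwd φ) = f'.map (bwd φ)

theorem AgreeOn.of_monoidGenerated (hμ : AgreeOn f f' fun _ : Fin 2 => (0 : Fin 1))
    (hη : AgreeOn f f' (Fin.elim0 : Fin 0 → Fin 1)) {φ : Fin m → Fin n}
    (hφ : MonoidGenerated φ) : AgreeOn f f' φ := by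
  induction hφ with
  | id_fun n => exact ⟨(f.map_id n).trans (f'.map_id n).symm, (f.map_id n).trans (f'.map_id n).symm⟩
  | comp _ _ hφ hψ =>
    constructor
    · rw [← fwd_comp_fwd, f.map_comp, f'.map_comp, hφ.1, hψ.1]
    · rw [← bwd_comp_bwd, f.map_comp, f'.map_comp, hφ.2, hψ.2]
  | sumMap _ _ hφ hψ =>
    constructor
    · rw [← fwd_tensor_fwd, f.map_tensor, f'.map_tensor, hφ.1, hψ.1]
    · rw [← bwd_tensor_bwd, f.map_tensor, f'.map_tensor, hφ.2, hψ.2]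
  | flip m n =>
    have hfwd (m n : ℕ) : f.map (fwd (finAddFlip (m := m) (n := n))) = f'.map (fwd finAddFlip) :=
      (f.map_braid m n).trans (f'.map_braid m n).symm
    exact ⟨hfwd m n, bwd_equiv (finAddFlip (m := m) (n := n)) ▸ hfwd n m⟩
  | mul => exact hμ
  | unit => exact hη

theorem morphism_ext (hμ : AgreeOn f f' fun _ : Fin 2 => (0 : Fin 1))
    (hη : AgreeOn f f' (Fin.elim0 : Fin 0 → Fin 1)) : f = f' := by
  have agree {m n : ℕ} (φ : Fin m → Fin n) : AgreeOn f f' φ :=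
    .of_monoidGenerated hμ hη (.of_function φ)
  ext m n x
  obtain ⟨q, φ, ψ, rfl⟩ := exists_eq_fwd_comp_bwd x
  rw [f.map_comp, f'.map_comp, (agree φ).1, (agree ψ).2]

end Generators

end FinCospan

namespace FinCorel

variable {m n : ℕ}

theorem cospanToCorel_surjective (R : FinCorel.Hom m n) :
    ∃ x : FinCospan.Hom m n, cospanToCorel.map x = R := by
  refine ⟨FinCospan.mk ⟨Corel.Parts R, Quotient.finite _, fun x => Corel.part R (Sum.inl x),
    fun y => Corel.part R (Sum.inr y)⟩, ?_⟩
  refine Eq.trans (Corel.ofFun_congr fun p q => ?_) (Corel.ofFun_part R)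
  rcases p with p | p <;> rcases q with q | q <;> rfl

theorem cospanToCorel_mk_one (a : Fin m → Fin 1) (b : Fin n → Fin 1) :
    cospanToCorel.map (FinCospan.mk ⟨Fin 1, inferInstance, a, b⟩) = corelTop m n :=
  Setoid.ext fun _ _ => iff_of_true (Subsingleton.elim (α := Fin 1) _ _) trivial

theorem morphism_ext {T : PROP.{w}} {K K' : PROP.Morphism FinCorel T}
    (hμ : K.map (corelTop 2 1) = K'.map (corelTop 2 1))
    (hη : K.map (corelTop 0 1) = K'.map (corelTop 0 1))
    (hδ : K.map (corelTop 1 2) = K'.map (corelTop 1 2))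
    (hε : K.map (corelTop 1 0) = K'.map (corelTop 1 0)) : K = K' := by
  have agree {m : ℕ} (a : Fin m → Fin 1) (hfwd : K.map (corelTop m 1) = K'.map (corelTop m 1))
      (hbwd : K.map (corelTop 1 m) = K'.map (corelTop 1 m)) :
      FinCospan.AgreeOn (cospanToCorel.comp K) (cospanToCorel.comp K') a :=
    ⟨by rwa [← cospanToCorel_mk_one a id] at hfwd, by rwa [← cospanToCorel_mk_one id a] at hbwd⟩
  have h : cospanToCorel.comp K = cospanToCorel.comp K' :=
    FinCospan.morphism_ext (agree _ hμ hδ) (agree _ hη hε)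
  ext m n R
  obtain ⟨x, rfl⟩ := cospanToCorel_surjective R
  exact congrArg (fun F : PROP.Morphism FinCospan T => F.map x) h

end FinCorel

/-! ## Lagrangian relations from corelations -/

section Lagrangian

variable {k : Type u} [Field k] {X Y Z X' Y' : Type}

open Matrix

namespace LagHom

theorem eq_of_le [Fintype X] [Fintype Y] {S T : LagHom k X Y} (h : S.1 ≤ T.1) : S = T :=
  Subtype.ext (S.2.2 T.1 T.2.1 h).symm

/-- The potentials at all terminals of a relation from `(k ⊕ k)^X` to `(k ⊕ k)^Y`. -/
def potential : ((X → k × k) × (Y → k × k)) →ₗ[k] (X ⊕ Y → k) where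
  toFun p := Sum.elim (fun x => (p.1 x).1) fun y => (p.2 y).1
  map_add' p q := by ext (x | y) <;> rfl
  map_smul' c p := by ext (x | y) <;> rfl

/-- The currents at all terminals of a relation from `(k ⊕ k)^X` to `(k ⊕ k)^Y`, all of them
counted as flowing out: those at `X`, which flow in, are negated. -/
def outflow : ((X → k × k) × (Y → k × k)) →ₗ[k] (X ⊕ Y → k) where
  toFun p := Sum.elim (fun x => -(p.1 x).2) fun y => (p.2 y).2
  map_add' p q := by ext (x | y) <;> simp [add_comm]
  map_smul' c p := by ext (x | y) <;> simp

theorem exists_potential_eq_and_outflow_eq (φ ψ : X ⊕ Y → k) :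
    ∃ p : (X → k × k) × (Y → k × k), potential p = φ ∧ outflow p = ψ :=
  ⟨(fun x => (φ (.inl x), -ψ (.inl x)), fun y => (φ (.inr y), ψ (.inr y))),
    by ext (x | y) <;> rfl, by ext (x | y) <;> simp [outflow]⟩

variable [Fintype X] [Fintype Y] [Fintype Z] [Fintype X'] [Fintype Y']

theorem dotProduct_outflow (ψ : X ⊕ Y → k) (p : (X → k × k) × (Y → k × k)) :
    ψ ⬝ᵥ outflow p = ∑ y, ψ (.inr y) * (p.2 y).2 - ∑ x, ψ (.inl x) * (p.1 x).2 := by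
  simp [dotProduct, outflow, neg_add_eq_sub]

theorem conjSum_eq_dotProduct (p q : (X → k × k) × (Y → k × k)) :
    conjSum (sympForm k X) (sympForm k Y) p q =
      potential p ⬝ᵥ outflow q - potential q ⬝ᵥ outflow p := by
  simp only [conjSum_apply, sympForm_apply, dotProduct_outflow, Finset.sum_sub_distrib, potential,
    LinearMap.coe_mk, AddHom.coe_mk, Sum.elim_inl, Sum.elim_inr]
  ring

/-- The functions annihilated by a space `C` of functions under the dot product. -/
def annihilator (C : Submodule k (X → k)) : Submodule k (X → k) :=
  LinearMap.BilinForm.orthogonal (dotProductBilin k k) C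

theorem annihilator_annihilator (C : Submodule k (X → k)) : annihilator (annihilator C) = C := by
  have symm : LinearMap.BilinForm.IsRefl (dotProductBilin k k : LinearMap.BilinForm k (X → k)) :=
    fun φ ψ h => (dotProduct_comm ψ φ).trans h
  refine LinearMap.BilinForm.orthogonal_orthogonal ?_ symm C
  exact (LinearMap.IsRefl.nondegenerate_iff_separatingLeft symm).2 fun φ h => dotProduct_eq_zero φ h

/-- The relation that allows the potentials in `C` and the outflows annihilated by `C`. -/
def conormal (C : Submodule k (X ⊕ Y → k)) : Submodule k ((X → k × k) × (Y → k × k)) :=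
  C.comap potential ⊓ (annihilator C).comap outflow

theorem mem_conormal_iff {C : Submodule k (X ⊕ Y → k)} {p : (X → k × k) × (Y → k × k)} :
    p ∈ conormal C ↔ potential p ∈ C ∧ ∀ ψ ∈ C, ψ ⬝ᵥ outflow p = 0 :=
  Iff.rfl

theorem isLagrangian_conormal (C : Submodule k (X ⊕ Y → k)) :
    IsLagrangian (conjSum (sympForm k X) (sympForm k Y)) (conormal C) := by
  refine (isLagrangian_iff (isAlt X Y)).2 fun q =>
    ⟨fun h => mem_conormal_iff.2 ⟨?_, fun ψ hψ => ?_⟩, fun hq p hp => ?_⟩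
  · rw [← annihilator_annihilator C]
    intro φ hφ
    obtain ⟨p, hp₁, hp₂⟩ := exists_potential_eq_and_outflow_eq (X := X) (Y := Y) 0 φ
    have hpq := h p ⟨by simp [hp₁], by simpa [hp₂] using hφ⟩
    rw [conjSum_eq_dotProduct, hp₁, hp₂, zero_dotProduct, zero_sub, neg_eq_zero] at hpq
    exact (dotProduct_comm _ _).trans hpq
  · obtain ⟨p, hp₁, hp₂⟩ := exists_potential_eq_and_outflow_eq (X := X) (Y := Y) ψ 0
    have hpq := h p ⟨by simpa [hp₁] using hψ, by simp [hp₂]⟩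
    rwa [conjSum_eq_dotProduct, hp₁, hp₂, dotProduct_zero, sub_zero] at hpq
  · rw [mem_conormal_iff] at hp hq
    rw [conjSum_eq_dotProduct, hq.2 _ hp.1, hp.2 _ hq.1, sub_zero]

end LagHom

namespace Corel

variable (k) in
/-- The functions that are constant on the parts of a corelation. -/
def blockConstant (R : Corel X Y) : Submodule k (X ⊕ Y → k) where
  carrier := {ψ | ∀ ⦃p q⦄, R.part p = R.part q → ψ p = ψ q}
  zero_mem' _ _ _ := rfl
  add_mem' hφ hψ _ _ h := congrArg₂ (· + ·) (hφ h) (hψ h)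
  smul_mem' c _ hφ _ _ h := congrArg (c * ·) (hφ h)

theorem mem_blockConstant_iff {R : Corel X Y} {ψ : X ⊕ Y → k} :
    ψ ∈ blockConstant k R ↔ ∀ ⦃p q⦄, R.part p = R.part q → ψ p = ψ q :=
  Iff.rfl

theorem mem_blockConstant_ofEquiv_iff {e : X ≃ Y} {ψ : X ⊕ Y → k} :
    ψ ∈ blockConstant k (ofEquiv e) ↔ ∀ x, ψ (.inl x) = ψ (.inr (e x)) := by
  simp only [mem_blockConstant_iff, ofEquiv, part_ofFun]
  constructor
  · exact fun h x => h rfl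
  · intro h p q hpq
    have factors (p : X ⊕ Y) : ψ p = ψ (.inr (Sum.elim e id p)) := by
      rcases p with x | y
      exacts [h x, rfl]
    rw [factors p, factors q, hpq]

theorem mem_blockConstant_tensor_iff {R : Corel X Y} {S : Corel X' Y'}
    {ψ : (X ⊕ X') ⊕ (Y ⊕ Y') → k} : ψ ∈ blockConstant k (R.tensor S) ↔
      ψ ∘ Sum.map Sum.inl Sum.inl ∈ blockConstant k R ∧
        ψ ∘ Sum.map Sum.inr Sum.inr ∈ blockConstant k S := by
  simp only [mem_blockConstant_iff, tensor, part_ofFun]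
  constructor
  · intro h
    constructor <;> rintro (p | p) (q | q) hpq <;> exact h (by simp [hpq])
  · rintro ⟨hR, hS⟩ ((p | p) | p | p) ((q | q) | q | q) hpq
    all_goals first
      | exact hR (Sum.inl_injective hpq)
      | exact hS (Sum.inr_injective hpq)
      | cases hpq

theorem glue_le_ker_iff {R : Corel X Y} {S : Corel Y Z} {χ : X ⊕ Y ⊕ Z → k} :
    glue R S ≤ Setoid.ker χ ↔
      χ ∘ Sum.map id Sum.inl ∈ blockConstant k R ∧ χ ∘ Sum.inr ∈ blockConstant k S := by
  constructor
  · exact fun h => ⟨fun p q hpq => h (.rel _ _ (.inl ⟨p, q, hpq, rfl, rfl⟩)),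
      fun p q hpq => h (.rel _ _ (.inr ⟨p, q, hpq, rfl, rfl⟩))⟩
  · rintro ⟨hR, hS⟩
    refine Setoid.eqvGen_le ?_
    rintro _ _ (⟨p, q, hpq, rfl, rfl⟩ | ⟨p, q, hpq, rfl, rfl⟩)
    · exact hR hpq
    · exact hS hpq

theorem mem_blockConstant_comp_iff {R : Corel X Y} {S : Corel Y Z} {ψ : X ⊕ Z → k} :
    ψ ∈ blockConstant k (R.comp S) ↔ ∃ χ : X ⊕ Y ⊕ Z → k, χ ∘ Sum.map id Sum.inr = ψ ∧
      χ ∘ Sum.map id Sum.inl ∈ blockConstant k R ∧ χ ∘ Sum.inr ∈ blockConstant k S := by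
  constructor
  · intro hψ
    let cl (p : X ⊕ Y ⊕ Z) : Quotient (glue R S) := Quotient.mk _ p
    let ext : Quotient (glue R S) → k := Function.extend (cl ∘ Sum.map id Sum.inr) ψ 0
    have factors : ψ.FactorsThrough (cl ∘ Sum.map id Sum.inr) := fun p q h =>
      hψ ((part_eq (R.comp S)).2 (Quotient.exact (s := glue R S) h))
    have le_ker : glue R S ≤ Setoid.ker (ext ∘ cl) := fun p q h => congrArg ext (Quotient.sound h)
    exact ⟨ext ∘ cl, funext fun p => factors.extend_apply 0 p, glue_le_ker_iff.1 le_ker⟩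
  · rintro ⟨χ, rfl, hχ⟩ p q h
    exact glue_le_ker_iff.2 hχ ((part_eq (R.comp S)).1 h)

variable [Fintype X] [Fintype Y] [Fintype Z] [Fintype X'] [Fintype Y']

open LagHom

theorem relEquiv_le_conormal (e : X ≃ Y) :
    relEquiv k e ≤ conormal (blockConstant k (ofEquiv e)) := by
  rintro ⟨u, w⟩ (rfl : u = w ∘ e)
  refine mem_conormal_iff.2 ⟨mem_blockConstant_ofEquiv_iff.2 fun _ => rfl, fun ψ hψ => ?_⟩
  simp only [dotProduct_outflow, mem_blockConstant_ofEquiv_iff.1 hψ,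
    Function.comp_apply, e.sum_comp fun y => ψ (.inr y) * (w y).2, sub_self]

theorem relComp_le_conormal (R : Corel X Y) (S : Corel Y Z) :
    relComp (conormal (blockConstant k R)) (conormal (blockConstant k S)) ≤
      conormal (blockConstant k (R.comp S)) := by
  rintro ⟨u, w⟩ ⟨v, hR, hS⟩
  rw [mem_conormal_iff] at hR hS ⊢
  constructor
  · let χ : X ⊕ Y ⊕ Z → k := Sum.elim (fun x => (u x).1) (potential (v, w))
    have hχ : χ ∘ Sum.map id Sum.inr = potential (u, w) := by ext (x | z) <;> rfl
    have hχR : χ ∘ Sum.map id Sum.inl = potential (u, v) := by ext (x | y) <;> rfl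
    exact mem_blockConstant_comp_iff.2 ⟨χ, hχ, hχR ▸ hR.1, hS.1⟩
  · intro ψ hψ
    obtain ⟨χ, rfl, hχR, hχS⟩ := mem_blockConstant_comp_iff.1 hψ
    have hR := hR.2 _ hχR
    have hS := hS.2 _ hχS
    simp only [dotProduct_outflow, Function.comp_apply, Sum.map_inl,
      Sum.map_inr, id_eq] at hR hS ⊢
    linear_combination hR + hS

theorem relSum_le_conormal (R : Corel X Y) (S : Corel X' Y') :
    relSum (conormal (blockConstant k R)) (conormal (blockConstant k S)) ≤
      conormal (blockConstant k (R.tensor S)) := by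
  rintro ⟨u, v⟩ ⟨hR, hS⟩
  rw [mem_conormal_iff] at hR hS ⊢
  constructor
  · rw [mem_blockConstant_tensor_iff]
    convert And.intro hR.1 hS.1 using 2 <;> ext (x | y) <;> rfl
  · intro ψ hψ
    obtain ⟨hψR, hψS⟩ := mem_blockConstant_tensor_iff.1 hψ
    have hR := hR.2 _ hψR
    have hS := hS.2 _ hψS
    simp only [dotProduct_outflow, Function.comp_apply,
      Fintype.sum_sum_type, Sum.map_inl, Sum.map_inr] at hR hS ⊢
    linear_combination hR + hS

variable (k) in
/-- The Lagrangian relation of a corelation: the potential is constant on each part and the net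
outflow of each part vanishes. -/
def toLagrangian : FinSetOps.Map ops (LagHom.ops k) where
  map R := ⟨conormal (blockConstant k R), isLagrangian_conormal _⟩
  map_ofEquiv e := (eq_of_le (relEquiv_le_conormal e)).symm
  map_comp R S := (eq_of_le (relComp_le_conormal R S)).symm
  map_tensor R S := (eq_of_le (relSum_le_conormal R S)).symm

end Corel

variable (k) in
/-- The morphism `K : FinCorel → LagRel_k`. -/
def corelToLagRel : PROP.Morphism FinCorel (LagRel k) :=
  (Corel.toLagrangian k).toMorphism Corel.lawful (LagHom.lawful k)

theorem mem_blockConstant_corelTop_iff {m n : ℕ} {ψ : Fin m ⊕ Fin n → k} :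
    ψ ∈ Corel.blockConstant k (corelTop m n) ↔ ∃ c, ∀ p, ψ p = c := by
  have part_eq_part (p q : Fin m ⊕ Fin n) :
      Corel.part (corelTop m n) p = Corel.part (corelTop m n) q := (Corel.part_eq _).2 trivial
  constructor
  · intro h
    rcases isEmpty_or_nonempty (Fin m ⊕ Fin n) with _ | ⟨⟨p⟩⟩
    · exact ⟨0, isEmptyElim⟩
    · exact ⟨ψ p, fun q => h (part_eq_part q p)⟩
  · exact fun ⟨c, hc⟩ p q _ => (hc p).trans (hc q).symm

theorem mem_corelToLagRel_corelTop_iff {m n : ℕ} (u : Fin m → k × k) (v : Fin n → k × k) :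
    (u, v) ∈ LagRel.rel ((corelToLagRel k).map (corelTop m n)) ↔
      (∃ c, (∀ i, (u i).1 = c) ∧ ∀ j, (v j).1 = c) ∧ ∑ i, (u i).2 = ∑ j, (v j).2 := by
  change (u, v) ∈ LagHom.conormal (Corel.blockConstant k (corelTop m n)) ↔ _
  simp only [LagHom.mem_conormal_iff, mem_blockConstant_corelTop_iff, LagHom.dotProduct_outflow,
    Sum.forall]
  refine and_congr Iff.rfl ⟨fun h => ?_, ?_⟩
  · have hsum := h (fun _ => 1) ⟨1, fun _ => rfl, fun _ => rfl⟩
    simpa only [one_mul] using (sub_eq_zero.1 hsum).symm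
  · rintro hsum ψ ⟨c, hu, hv⟩
    simp only [hu, hv, ← Finset.mul_sum, hsum, sub_self]

theorem corelToLagRel_sendsFrobenius : SendsFrobenius (corelToLagRel k) := by
  refine ⟨fun u v => ?_, fun u v => ?_, fun u v => ?_, fun u v => ?_⟩ <;>
    rw [mem_corelToLagRel_corelTop_iff] <;> simp [Fin.forall_fin_two] <;> grind

theorem LagRel.ext {m n : ℕ} {S T : (LagRel k).Hom m n}
    (h : ∀ u v, (u, v) ∈ LagRel.rel S ↔ (u, v) ∈ LagRel.rel T) : S = T :=
  LagHom.ext' h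

theorem SendsFrobenius.unique {K K' : PROP.Morphism FinCorel (LagRel k)} (hK : SendsFrobenius K)
    (hK' : SendsFrobenius K') : K = K' :=
  FinCorel.morphism_ext (LagRel.ext fun u v => (hK.1 u v).trans (hK'.1 u v).symm)
    (LagRel.ext fun u v => (hK.2.1 u v).trans (hK'.2.1 u v).symm)
    (LagRel.ext fun u v => (hK.2.2.1 u v).trans (hK'.2.2.1 u v).symm)
    (LagRel.ext fun u v => (hK.2.2.2 u v).trans (hK'.2.2.2 u v).symm)

end Lagrangian

/-! ## Attaching morphisms to the nodes of a graph -/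

namespace PROP

variable {T : PROP.{w}} {m n p q m' n' p' : ℕ}

theorem tensor_id_comp_id_tensor (a : T.Hom m n) (b : T.Hom p q) :
    (a ⊗ T.id p) ≫ (T.id n ⊗ b) = a ⊗ b := by
  rw [← T.tensor_comp, T.id_comp, T.comp_id]

theorem id_tensor_comp_tensor_id (a : T.Hom m n) (b : T.Hom p q) :
    (T.id m ⊗ b) ≫ (a ⊗ T.id q) = a ⊗ b := by
  rw [← T.tensor_comp, T.id_comp, T.comp_id]

theorem comp_tensor_id (x : T.Hom m n) (y : T.Hom n p) (q : ℕ) :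
    (x ≫ y) ⊗ T.id q = (x ⊗ T.id q) ≫ (y ⊗ T.id q) := by
  rw [← T.tensor_comp, T.id_comp]

theorem id_tensor_comp (x : T.Hom m n) (y : T.Hom n p) (q : ℕ) :
    T.id q ⊗ (x ≫ y) = (T.id q ⊗ x) ≫ (T.id q ⊗ y) := by
  rw [← T.tensor_comp, T.id_comp]

theorem braid_comp_left_cancel {x y : T.Hom (n + m) p}
    (h : T.braid m n ≫ x = T.braid m n ≫ y) : x = y := by
  rw [← T.id_comp x, ← T.id_comp y, ← T.braid_braid n m, T.assoc, T.assoc, h]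

theorem castHom_comp_castHom_comp_castHom (hn : n = n') (hp : p = p') (x : T.Hom m n)
    (y : T.Hom n p) (z : T.Hom p q) :
    castHom (Hom := T.Hom) rfl hn x ≫ castHom (Hom := T.Hom) hn hp y ≫
      castHom (Hom := T.Hom) hp rfl z = x ≫ y ≫ z := by
  subst hn hp
  rfl

theorem Morphism.map_castHom {S : PROP.{v}} (f : Morphism S T) (hm : m = m') (hn : n = n')
    (x : S.Hom m n) :
    f.map (castHom (Hom := S.Hom) hm hn x) = castHom (Hom := T.Hom) hm hn (f.map x) := by
  subst hm hn
  rfl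

end PROP

namespace FinCospan

variable {m n p q n' : ℕ}

theorem castHom_fwd (h : m = p) (φ : Fin m → Fin n) :
    castHom (Hom := FinCospan.Hom) h rfl (fwd φ) = fwd (φ ∘ Fin.cast h.symm) := by
  subst h
  rfl

theorem castHom_bwd (h : m = p) (φ : Fin m → Fin n) :
    castHom (Hom := FinCospan.Hom) rfl h (bwd φ) = bwd (φ ∘ Fin.cast h.symm) := by
  subst h
  rfl

theorem id_tensor_fwd (p : ℕ) (φ : Fin n → Fin n') :
    FinCospan.id p ⊗ fwd φ = fwd (finSumMap id φ) :=
  fwd_tensor_fwd id φ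

theorem id_tensor_bwd (p : ℕ) (φ : Fin n → Fin n') :
    FinCospan.id p ⊗ bwd φ = bwd (finSumMap id φ) :=
  bwd_tensor_bwd id φ

theorem fwd_append_id_comp_fwd (σ : Fin p → Fin n) (φ : Fin n → Fin n') :
    fwd (Fin.append σ id) ≫ fwd φ =
      (FinCospan.id p ⊗ fwd φ) ≫ fwd (Fin.append (φ ∘ σ) id) := by
  rw [id_tensor_fwd, fwd_comp_fwd, fwd_comp_fwd, append_comp_finSumMap, comp_append]
  rfl

theorem bwd_comp_bwd_append_id (σ : Fin p → Fin n) (φ : Fin n → Fin n') :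
    bwd φ ≫ bwd (Fin.append σ id) =
      bwd (Fin.append (φ ∘ σ) id) ≫ (FinCospan.id p ⊗ bwd φ) := by
  rw [id_tensor_bwd, bwd_comp_bwd, bwd_comp_bwd, append_comp_finSumMap, comp_append]
  rfl

theorem bwd_append_id_comp_fwd (σ : Fin p → Fin n) (φ : Fin n → Fin n') :
    bwd (Fin.append σ id) ≫ (FinCospan.id p ⊗ fwd φ) =
      fwd φ ≫ bwd (Fin.append (φ ∘ σ) id) := by
  rw [id_tensor_fwd, bwd_comp_fwd (isPushoutSquare_append_id σ φ)]

theorem fwd_append_id_comp_bwd (σ : Fin p → Fin n) (φ : Fin n → Fin n') :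
    fwd (Fin.append (φ ∘ σ) id) ≫ bwd φ =
      (FinCospan.id p ⊗ bwd φ) ≫ fwd (Fin.append σ id) := by
  rw [id_tensor_bwd, bwd_comp_fwd (isPushoutSquare_append_id σ φ).symm]

theorem finSumMap_append_id_comp_cast (σ : Fin p → Fin n) (m : ℕ) :
    finSumMap (Fin.append σ id) (id : Fin m → Fin m) ∘ Fin.cast (Nat.add_assoc p n m).symm =
      Fin.append (Fin.castAdd m ∘ σ) id := by
  funext x
  refine Fin.addCases (fun x => ?_) (Fin.addCases (fun x => ?_) fun x => ?_) x
  · have hx : Fin.cast (Nat.add_assoc p n m).symm (Fin.castAdd (n + m) x) =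
        Fin.castAdd m (Fin.castAdd n x) := rfl
    simp only [Function.comp_apply, hx, finSumMap_castAdd, Fin.append_left]
  · have hx : Fin.cast (Nat.add_assoc p n m).symm (Fin.natAdd p (Fin.castAdd m x)) =
        Fin.castAdd m (Fin.natAdd p x) := rfl
    simp only [Function.comp_apply, hx, finSumMap_castAdd, Fin.append_right, id]
  · have hx : Fin.cast (Nat.add_assoc p n m).symm (Fin.natAdd p (Fin.natAdd n x)) =
        Fin.natAdd (p + n) x := Fin.ext (Nat.add_assoc p n x).symm
    simp only [Function.comp_apply, hx, finSumMap_natAdd, Fin.append_right, id]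

section Attach

variable {T : PROP.{w}} (f : PROP.Morphism FinCospan T)

/-- The endomorphism that attaches a morphism `a` to the nodes of a graph, joining its inputs and
outputs to the nodes prescribed by `σ` and `τ`.  For `a : 1 → 1` this adds an edge. -/
def attach (a : T.Hom p q) (σ : Fin p → Fin n) (τ : Fin q → Fin n) : T.Hom n n :=
  f.map (bwd (Fin.append σ id)) ≫ (a ⊗ T.id n) ≫ f.map (fwd (Fin.append τ id))

theorem tensor_id_comp_map_id_tensor (a : T.Hom p q) (x : FinCospan.Hom n n') :
    (a ⊗ T.id n) ≫ f.map (FinCospan.id q ⊗ x) =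
      f.map (FinCospan.id p ⊗ x) ≫ (a ⊗ T.id n') := by
  rw [f.map_tensor, f.map_tensor, f.map_id, f.map_id, T.tensor_id_comp_id_tensor,
    T.id_tensor_comp_tensor_id]

theorem map_id_tensor_comp_tensor_id_comp_map_id_tensor {r : ℕ} (a : T.Hom p q)
    (x : FinCospan.Hom n r) (y : FinCospan.Hom r n') :
    f.map (FinCospan.id p ⊗ x) ≫ (a ⊗ T.id r) ≫ f.map (FinCospan.id q ⊗ y) =
      f.map (FinCospan.id p ⊗ (x ≫ y)) ≫ (a ⊗ T.id n') := by
  rw [tensor_id_comp_map_id_tensor, ← T.assoc, ← f.map_comp]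
  exact congrArg (fun z => f.map z ≫ _) (FinCospan.id_tensor_comp x y p).symm

theorem attach_comp_map_of_slide (a : T.Hom p q) {σ : Fin p → Fin n} {τ : Fin q → Fin n}
    {σ' : Fin p → Fin n'} {τ' : Fin q → Fin n'} {x : FinCospan.Hom n n'}
    (hσ : bwd (Fin.append σ id) ≫ (FinCospan.id p ⊗ x) = x ≫ bwd (Fin.append σ' id))
    (hτ : fwd (Fin.append τ id) ≫ x = (FinCospan.id q ⊗ x) ≫ fwd (Fin.append τ' id)) :
    attach f a σ τ ≫ f.map x = f.map x ≫ attach f a σ' τ' := by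
  calc attach f a σ τ ≫ f.map x
    _ = f.map (bwd (Fin.append σ id)) ≫ (a ⊗ T.id n) ≫
          f.map (fwd (Fin.append τ id) ≫ x) := by
      rw [attach, T.assoc, T.assoc, f.map_comp]
    _ = f.map (bwd (Fin.append σ id)) ≫ ((a ⊗ T.id n) ≫ f.map (FinCospan.id q ⊗ x)) ≫
          f.map (fwd (Fin.append τ' id)) := by
      rw [hτ, f.map_comp, T.assoc]
    _ = f.map (bwd (Fin.append σ id) ≫ (FinCospan.id p ⊗ x)) ≫ (a ⊗ T.id n') ≫
          f.map (fwd (Fin.append τ' id)) := by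
      rw [tensor_id_comp_map_id_tensor, f.map_comp, T.assoc, T.assoc]
    _ = f.map x ≫ attach f a σ' τ' := by
      rw [hσ, f.map_comp, T.assoc, attach]

theorem attach_comp_fwd (a : T.Hom p q) (σ : Fin p → Fin n) (τ : Fin q → Fin n)
    (φ : Fin n → Fin n') :
    attach f a σ τ ≫ f.map (fwd φ) = f.map (fwd φ) ≫ attach f a (φ ∘ σ) (φ ∘ τ) :=
  attach_comp_map_of_slide f a (bwd_append_id_comp_fwd σ φ) (fwd_append_id_comp_fwd τ φ)

theorem attach_comp_bwd (a : T.Hom p q) (σ : Fin p → Fin n) (τ : Fin q → Fin n)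
    (φ : Fin n → Fin n') :
    attach f a (φ ∘ σ) (φ ∘ τ) ≫ f.map (bwd φ) = f.map (bwd φ) ≫ attach f a σ τ :=
  attach_comp_map_of_slide f a (bwd_comp_bwd_append_id σ φ).symm (fwd_append_id_comp_bwd τ φ)

theorem attach_tensor_id (a : T.Hom p q) (σ : Fin p → Fin n) (τ : Fin q → Fin n) (m : ℕ) :
    attach f a σ τ ⊗ T.id m = attach f a (Fin.castAdd m ∘ σ) (Fin.castAdd m ∘ τ) := by
  have hp := Nat.add_assoc p n m
  have hq := Nat.add_assoc q n m
  have hB : castHom (Hom := T.Hom) rfl hp (f.map (bwd (Fin.append σ id)) ⊗ T.id m) =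
      f.map (bwd (Fin.append (Fin.castAdd m ∘ σ) id)) := by
    rw [← finSumMap_append_id_comp_cast, ← castHom_bwd hp, f.map_castHom, ← bwd_tensor_bwd,
      f.map_tensor, bwd_id, f.map_id]
  have hF : castHom (Hom := T.Hom) hq rfl (f.map (fwd (Fin.append τ id)) ⊗ T.id m) =
      f.map (fwd (Fin.append (Fin.castAdd m ∘ τ) id)) := by
    rw [← finSumMap_append_id_comp_cast, ← castHom_fwd hq, f.map_castHom, ← fwd_tensor_fwd,
      f.map_tensor, fwd_id, f.map_id]
  have ha : castHom (Hom := T.Hom) hp hq ((a ⊗ T.id n) ⊗ T.id m) = a ⊗ T.id (n + m) := by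
    rw [T.tensor_assoc, T.tensor_id]
  rw [attach, attach, T.comp_tensor_id, T.comp_tensor_id, ← hB, ← hF, ← ha]
  exact (T.castHom_comp_castHom_comp_castHom hp hq _ _ _).symm

theorem id_tensor_attach (a : T.Hom p q) (σ : Fin p → Fin n) (τ : Fin q → Fin n) (m : ℕ) :
    T.id m ⊗ attach f a σ τ = attach f a (Fin.natAdd m ∘ σ) (Fin.natAdd m ∘ τ) := by
  have flip_comp_castAdd {r : ℕ} (ρ : Fin r → Fin n) :
      finAddFlip ∘ Fin.castAdd m ∘ ρ = Fin.natAdd m ∘ ρ :=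
    funext fun i => finAddFlip_apply_castAdd (ρ i) m
  have map_flip : f.map (fwd (finAddFlip (m := n) (n := m))) = T.braid n m := f.map_braid n m
  refine T.braid_comp_left_cancel ?_
  rw [← T.braid_natural, attach_tensor_id, ← map_flip, attach_comp_fwd, flip_comp_castAdd,
    flip_comp_castAdd]

/- Two copies of the graph make room for the two attachments side by side, where they commute. -/
theorem attach_comm {p' q' : ℕ} (a : T.Hom p q) (σ : Fin p → Fin n) (τ : Fin q → Fin n)
    (b : T.Hom p' q') (σ' : Fin p' → Fin n) (τ' : Fin q' → Fin n) :
    attach f a σ τ ≫ attach f b σ' τ' = attach f b σ' τ' ≫ attach f a σ τ := by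
  let fold : Fin (n + n) → Fin n := Fin.append id id
  have fold_castAdd {r : ℕ} (ρ : Fin r → Fin n) : fold ∘ Fin.castAdd n ∘ ρ = ρ :=
    funext fun i => Fin.append_left id id (ρ i)
  have fold_natAdd {r : ℕ} (ρ : Fin r → Fin n) : fold ∘ Fin.natAdd n ∘ ρ = ρ :=
    funext fun i => Fin.append_right id id (ρ i)
  have map_fold_section : f.map (fwd (Fin.castAdd n)) ≫ f.map (fwd fold) = T.id n := by
    rw [← f.map_comp, fwd_comp_fwd, ← Function.comp_id (Fin.castAdd n), fold_castAdd, fwd_id,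
      f.map_id]
  have ha := attach_comp_fwd f a (Fin.castAdd n ∘ σ) (Fin.castAdd n ∘ τ) fold
  have hb := attach_comp_fwd f b (Fin.natAdd n ∘ σ') (Fin.natAdd n ∘ τ') fold
  rw [← attach_tensor_id, fold_castAdd, fold_castAdd] at ha
  rw [← id_tensor_attach, fold_natAdd, fold_natAdd] at hb
  have fold_comp_ab : f.map (fwd fold) ≫ attach f a σ τ ≫ attach f b σ' τ' =
      (attach f a σ τ ⊗ attach f b σ' τ') ≫ f.map (fwd fold) := by
    rw [← T.assoc, ← ha, T.assoc, ← hb, ← T.assoc, T.tensor_id_comp_id_tensor]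
  have fold_comp_ba : f.map (fwd fold) ≫ attach f b σ' τ' ≫ attach f a σ τ =
      (attach f a σ τ ⊗ attach f b σ' τ') ≫ f.map (fwd fold) := by
    rw [← T.assoc, ← hb, T.assoc, ← ha, ← T.assoc, T.id_tensor_comp_tensor_id]
  rw [← T.id_comp (attach f a σ τ ≫ attach f b σ' τ'), ← map_fold_section, T.assoc, fold_comp_ab,
    ← fold_comp_ba, ← T.assoc, map_fold_section, T.id_comp]

theorem fwd_castAdd_comp_bwd_natAdd (p q : ℕ) :
    fwd (Fin.castAdd q) ≫ bwd (Fin.natAdd p) =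
      bwd (Fin.elim0 : Fin 0 → Fin p) ≫ fwd (Fin.elim0 : Fin 0 → Fin q) :=
  (bwd_comp_fwd (isPushoutSquare_elim0 p q)).symm

theorem fwd_castAdd_comp_attach_comp_bwd_natAdd (a : T.Hom p q) :
    f.map (fwd (Fin.castAdd q)) ≫ attach f a (Fin.castAdd q) (Fin.natAdd p) ≫
      f.map (bwd (Fin.natAdd p)) = a := by
  have hσ := bwd_append_id_comp_fwd id (Fin.castAdd (m := q) (n := p))
  have hτ := fwd_append_id_comp_bwd id (Fin.natAdd (m := q) p)
  have append_elim0 (r : ℕ) :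
      Fin.append id id ∘ finSumMap (id : Fin r → Fin r) (Fin.elim0 : Fin 0 → Fin r) = id := by
    rw [append_comp_finSumMap]
    exact Fin.append_elim0 _
  rw [Function.comp_id] at hσ hτ
  calc f.map (fwd (Fin.castAdd q)) ≫ attach f a (Fin.castAdd q) (Fin.natAdd p) ≫
      f.map (bwd (Fin.natAdd p))
    _ = f.map (fwd (Fin.castAdd q) ≫ bwd (Fin.append (Fin.castAdd q) id)) ≫
          (a ⊗ T.id (p + q)) ≫
          f.map (fwd (Fin.append (Fin.natAdd p) id) ≫ bwd (Fin.natAdd p)) := by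
      rw [attach, f.map_comp, f.map_comp]
      simp only [T.assoc]
    _ = f.map (bwd (Fin.append id id)) ≫ (f.map (FinCospan.id p ⊗ fwd (Fin.castAdd q)) ≫
          (a ⊗ T.id (p + q)) ≫ f.map (FinCospan.id q ⊗ bwd (Fin.natAdd p))) ≫
          f.map (fwd (Fin.append id id)) := by
      rw [← hσ, hτ, f.map_comp, f.map_comp]
      simp only [T.assoc]
    _ = f.map (bwd (Fin.append id id)) ≫ (f.map (FinCospan.id p ⊗ bwd Fin.elim0) ≫
          (a ⊗ T.id 0) ≫ f.map (FinCospan.id q ⊗ fwd Fin.elim0)) ≫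
          f.map (fwd (Fin.append id id)) := by
      rw [map_id_tensor_comp_tensor_id_comp_map_id_tensor, fwd_castAdd_comp_bwd_natAdd,
        ← map_id_tensor_comp_tensor_id_comp_map_id_tensor]
    _ = f.map (bwd (Fin.append id id) ≫ (FinCospan.id p ⊗ bwd Fin.elim0)) ≫ (a ⊗ T.id 0) ≫
          f.map ((FinCospan.id q ⊗ fwd Fin.elim0) ≫ fwd (Fin.append id id)) := by
      rw [f.map_comp, f.map_comp]
      simp only [T.assoc]
    _ = a := by
      rw [id_tensor_bwd, id_tensor_fwd, bwd_comp_bwd, fwd_comp_fwd, append_elim0, append_elim0]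
      exact (congrArg₂ T.comp (f.map_id p) (congrArg₂ T.comp (T.tensor_unit a) (f.map_id q))).trans
        ((T.id_comp _).trans (T.comp_id a))

end Attach

end FinCospan

/-! ## Attaching a finite family of edges -/

/-- The monoid of endomorphisms of `n` in a prop, with composition in diagrammatic order. -/
def PROP.End (T : PROP.{w}) (n : ℕ) : Type w := T.Hom n n

instance (T : PROP.{w}) (n : ℕ) : Monoid (T.End n) where
  mul := T.comp
  one := T.id n
  mul_assoc := T.assoc
  one_mul := T.id_comp
  mul_one := T.comp_id

namespace FinCospan

variable {T : PROP.{w}} (f : PROP.Morphism FinCospan T)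

/-- The endomorphism of `n` that joins node `s` to node `t` by an edge of value `a`. -/
def attachEdge {n : ℕ} (a : T.Hom 1 1) (s t : Fin n) : T.End n :=
  attach f a (fun _ => s) (fun _ => t)

/-- The submonoid of endomorphisms of `n` generated by attaching edges.  It is commutative, so
finite families of edges can be attached without choosing an order. -/
def edgeMonoid (n : ℕ) : Submonoid (T.End n) :=
  Submonoid.closure (Set.range fun i : T.Hom 1 1 × Fin n × Fin n => attachEdge f i.1 i.2.1 i.2.2)

theorem edgeMonoid_isMulCommutative (n : ℕ) : IsMulCommutative (edgeMonoid f n) :=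
  Submonoid.isMulCommutative_closure (T.End n) (by
    rintro _ ⟨i, rfl⟩ _ ⟨j, rfl⟩
    exact attach_comm f _ _ _ _ _ _)

instance (n : ℕ) : CommMonoid (edgeMonoid f n) :=
  { (edgeMonoid f n).toMonoid with
    mul_comm := (edgeMonoid_isMulCommutative f n).is_comm.comm }

/-- `attachEdge` as an element of the commutative monoid `edgeMonoid`. -/
def edgeMonoid.of {n : ℕ} (a : T.Hom 1 1) (s t : Fin n) : edgeMonoid f n :=
  ⟨attachEdge f a s t, Submonoid.subset_closure ⟨(a, s, t), rfl⟩⟩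

/-- The endomorphism that attaches a finite family of edges with values `a`, sources `src` and
targets `tgt`. -/
noncomputable def attachEdges {n : ℕ} {E : Type} (a : E → T.Hom 1 1) (src tgt : E → Fin n) :
    T.Hom n n :=
  (∏ᶠ e, edgeMonoid.of f (a e) (src e) (tgt e)).1

variable {n n' : ℕ} {E E' : Type}

theorem attachEdges_comp_equiv (ε : E ≃ E') (a : E' → T.Hom 1 1) (src tgt : E' → Fin n) :
    attachEdges f (a ∘ ε) (src ∘ ε) (tgt ∘ ε) = attachEdges f a src tgt :=
  congrArg Subtype.val
    (finprod_comp_equiv ε (f := fun e => edgeMonoid.of f (a e) (src e) (tgt e)))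

theorem attachEdges_of_isEmpty [IsEmpty E] (a : E → T.Hom 1 1) (src tgt : E → Fin n) :
    attachEdges f a src tgt = T.id n :=
  congrArg Subtype.val (finprod_of_isEmpty fun e => edgeMonoid.of f (a e) (src e) (tgt e))

theorem attachEdges_of_unique [Unique E] (a : E → T.Hom 1 1) (src tgt : E → Fin n) :
    attachEdges f a src tgt = attachEdge f (a default) (src default) (tgt default) :=
  congrArg Subtype.val (finprod_unique fun e => edgeMonoid.of f (a e) (src e) (tgt e))

theorem attachEdges_sum [Finite E] [Finite E'] (a : E ⊕ E' → T.Hom 1 1)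
    (src tgt : E ⊕ E' → Fin n) :
    attachEdges f a src tgt =
      attachEdges f (a ∘ Sum.inl) (src ∘ Sum.inl) (tgt ∘ Sum.inl) ≫
        attachEdges f (a ∘ Sum.inr) (src ∘ Sum.inr) (tgt ∘ Sum.inr) := by
  have := Fintype.ofFinite E
  have := Fintype.ofFinite E'
  simp only [attachEdges, finprod_eq_prod_of_fintype, Fintype.prod_sum_type]
  rfl

variable {f} in
theorem attachEdges_induction [Finite E] {S : PROP.{u}} {g : PROP.Morphism FinCospan S}
    {a : E → T.Hom 1 1} {src tgt : E → Fin n} {b : E → S.Hom 1 1} {src' tgt' : E → Fin n'}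
    (r : T.Hom n n → S.Hom n' n' → Prop) (id : r (T.id n) (S.id n'))
    (comp : ∀ x y x' y', r x x' → r y y' → r (x ≫ y) (x' ≫ y'))
    (attachEdge : ∀ e, r (attachEdge f (a e) (src e) (tgt e))
      (attachEdge g (b e) (src' e) (tgt' e))) :
    r (attachEdges f a src tgt) (attachEdges g b src' tgt') := by
  classical
  have := Fintype.ofFinite E
  simp only [attachEdges, finprod_eq_prod_of_fintype]
  suffices H : ∀ s : Finset E, r (∏ e ∈ s, edgeMonoid.of f (a e) (src e) (tgt e)).1
      (∏ e ∈ s, edgeMonoid.of g (b e) (src' e) (tgt' e)).1 from H _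
  intro s
  induction s using Finset.induction_on with
  | empty => exact id
  | insert e s he ih =>
    rw [Finset.prod_insert he, Finset.prod_insert he]
    exact comp _ _ _ _ (attachEdge e) ih

theorem attachEdges_comp_fwd [Finite E] (a : E → T.Hom 1 1) (src tgt : E → Fin n)
    (φ : Fin n → Fin n') :
    attachEdges f a src tgt ≫ f.map (fwd φ) =
      f.map (fwd φ) ≫ attachEdges f a (φ ∘ src) (φ ∘ tgt) := by
  refine attachEdges_induction (fun x x' => x ≫ f.map (fwd φ) = f.map (fwd φ) ≫ x') ?_
    (fun x y x' y' hx hy => ?_) fun e => attach_comp_fwd f _ _ _ φ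
  · rw [T.id_comp, T.comp_id]
  · rw [T.assoc, hy, ← T.assoc, hx, T.assoc]

theorem attachEdges_comp_bwd [Finite E] (a : E → T.Hom 1 1) (src tgt : E → Fin n)
    (φ : Fin n → Fin n') :
    attachEdges f a (φ ∘ src) (φ ∘ tgt) ≫ f.map (bwd φ) =
      f.map (bwd φ) ≫ attachEdges f a src tgt := by
  refine attachEdges_induction (fun x x' => x ≫ f.map (bwd φ) = f.map (bwd φ) ≫ x') ?_
    (fun x y x' y' hx hy => ?_) fun e => attach_comp_bwd f _ _ _ φ
  · rw [T.id_comp, T.comp_id]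
  · rw [T.assoc, hy, ← T.assoc, hx, T.assoc]

theorem attachEdges_tensor_id [Finite E] (a : E → T.Hom 1 1) (src tgt : E → Fin n) (m : ℕ) :
    attachEdges f a src tgt ⊗ T.id m =
      attachEdges f a (Fin.castAdd m ∘ src) (Fin.castAdd m ∘ tgt) := by
  refine attachEdges_induction (fun x x' => x ⊗ T.id m = x') (T.tensor_id n m) ?_
    fun e => attach_tensor_id f _ _ _ m
  rintro x y _ _ rfl rfl
  exact T.comp_tensor_id x y m

theorem id_tensor_attachEdges [Finite E] (a : E → T.Hom 1 1) (src tgt : E → Fin n) (m : ℕ) :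
    T.id m ⊗ attachEdges f a src tgt =
      attachEdges f a (Fin.natAdd m ∘ src) (Fin.natAdd m ∘ tgt) := by
  refine attachEdges_induction (fun x x' => T.id m ⊗ x = x') (T.tensor_id m n) ?_
    fun e => id_tensor_attach f _ _ _ m
  rintro x y _ _ rfl rfl
  exact T.id_tensor_comp x y m

theorem attachEdges_tensor [Finite E] [Finite E'] (a : E → T.Hom 1 1) (src tgt : E → Fin n)
    (a' : E' → T.Hom 1 1) (src' tgt' : E' → Fin n') :
    attachEdges f a src tgt ⊗ attachEdges f a' src' tgt' =
      attachEdges f (Sum.elim a a') (finSumFinEquiv ∘ Sum.map src src')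
        (finSumFinEquiv ∘ Sum.map tgt tgt') := by
  rw [← T.tensor_id_comp_id_tensor, attachEdges_tensor_id, id_tensor_attachEdges, attachEdges_sum]
  rfl

theorem map_attachEdges [Finite E] {S : PROP.{u}} (h : PROP.Morphism T S) (a : E → T.Hom 1 1)
    (src tgt : E → Fin n) :
    h.map (attachEdges f a src tgt) = attachEdges (f.comp h) (h.map ∘ a) src tgt := by
  refine attachEdges_induction (fun x x' => h.map x = x') (h.map_id n) ?_ fun e => ?_
  · rintro x y _ _ rfl rfl
    exact h.map_comp x y
  · simp only [attachEdge, attach, h.map_comp, h.map_tensor, h.map_id]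
    rfl

end FinCospan

/-! ## Circuits -/

namespace Circ

open FinCospan

variable {L : Type v} {m n p q m' n' q' : ℕ}

/-- The morphism of `Circ L` represented by the circuit with the given data. -/
def graph {N E : Type} [Finite N] [Finite E] (inp : Fin m → N) (out : Fin n → N) (src tgt : E → N)
    (lab : E → L) : (Circ L).Hom m n :=
  Quotient.mk (Circuit.setoid L (Fin m) (Fin n))
    ⟨⟨N, inferInstance, inp, out⟩, E, inferInstance, src, tgt, lab⟩

/-- The morphism of `Circ L` represented by the circuit with a single edge, labelled `l`. -/
def edge (l : L) : (Circ L).Hom 1 1 :=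
  graph (N := Fin 2) (E := Unit) (fun _ => 0) (fun _ => 1) (fun _ => 0) (fun _ => 1) fun _ => l

section Graph

variable {N M V E E' : Type} [Finite N] [Finite M] [Finite V] [Finite E] [Finite E']

theorem graph_congr {inp : Fin m → N} {out : Fin n → N} {src tgt : E → N} {lab : E → L}
    {inp' : Fin m → M} {out' : Fin n → M} {src' tgt' : E' → M} {lab' : E' → L} (σ : N ≃ M)
    (ε : E ≃ E') (hinp : ∀ x, σ (inp x) = inp' x) (hout : ∀ x, σ (out x) = out' x)
    (hsrc : ∀ e, σ (src e) = src' (ε e)) (htgt : ∀ e, σ (tgt e) = tgt' (ε e))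
    (hlab : ∀ e, lab e = lab' (ε e)) :
    graph inp out src tgt lab = graph inp' out' src' tgt' lab' :=
  Quotient.sound ⟨σ, ε, hinp, hout, hsrc, htgt, hlab⟩

theorem exists_eq_graph (x : (Circ L).Hom m n) :
    ∃ (q : ℕ) (inp : Fin m → Fin q) (out : Fin n → Fin q) (E : Type) (_ : Finite E)
      (src tgt : E → Fin q) (lab : E → L), x = graph inp out src tgt lab := by
  obtain ⟨c⟩ := x
  obtain ⟨q, ⟨e⟩⟩ := Finite.exists_equiv_fin c.N
  exact ⟨q, e ∘ c.inp, e ∘ c.out, c.E, c.finite_E, e ∘ c.src, e ∘ c.tgt, c.lab,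
    graph_congr e (Equiv.refl c.E) (fun _ => rfl) (fun _ => rfl) (fun _ => rfl) (fun _ => rfl)
      fun _ => rfl⟩

theorem cospanIncl_mk (c : Cospan (Fin m) (Fin n)) :
    (cospanIncl L).map (FinCospan.mk c) =
      graph c.inp c.out (Empty.elim : Empty → c.N) Empty.elim Empty.elim :=
  rfl

theorem graph_of_isEmpty [IsEmpty E] (inp : Fin m → N) (out : Fin n → N) (src tgt : E → N)
    (lab : E → L) :
    graph inp out src tgt lab = (cospanIncl L).map (FinCospan.mk ⟨N, inferInstance, inp, out⟩) :=
  graph_congr (Equiv.refl N) (Equiv.equivOfIsEmpty E Empty) (fun _ => rfl) (fun _ => rfl)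
    isEmptyElim isEmptyElim isEmptyElim

variable {inp : Fin m → N} {out : Fin n → N} {src tgt : E → N} {lab : E → L} {inp' : Fin n → M}
  {out' : Fin p → M} {src' tgt' : E' → M} {lab' : E' → L} {a : N → V} {b : M → V}

theorem graph_comp_graph (H : IsPushoutSquare out inp' a b) :
    graph inp out src tgt lab ≫ graph inp' out' src' tgt' lab' =
      graph (a ∘ inp) (b ∘ out') (Sum.elim (a ∘ src) (b ∘ src'))
        (Sum.elim (a ∘ tgt) (b ∘ tgt')) (Sum.elim lab lab') := by
  obtain ⟨h, hbij⟩ := H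
  refine graph_congr (Equiv.ofBijective _ hbij) (Equiv.refl _) (fun _ => rfl) (fun _ => rfl) ?_ ?_
    fun _ => rfl
  · exact Sum.rec (fun _ => rfl) fun _ => rfl
  · exact Sum.rec (fun _ => rfl) fun _ => rfl

theorem cospanIncl_mk_comp_graph (H : IsPushoutSquare out inp' a b) :
    (cospanIncl L).map (FinCospan.mk ⟨N, inferInstance, inp, out⟩) ≫
        graph inp' out' src' tgt' lab' =
      graph (a ∘ inp) (b ∘ out') (b ∘ src') (b ∘ tgt') lab' := by
  rw [cospanIncl_mk, graph_comp_graph H]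
  refine graph_congr (Equiv.refl V) (Equiv.emptySum Empty E') (fun _ => rfl) (fun _ => rfl) ?_ ?_ ?_
  all_goals exact Sum.rec isEmptyElim fun _ => rfl

theorem graph_comp_cospanIncl_mk (H : IsPushoutSquare out inp' a b) :
    graph inp out src tgt lab ≫
        (cospanIncl L).map (FinCospan.mk ⟨M, inferInstance, inp', out'⟩) =
      graph (a ∘ inp) (b ∘ out') (a ∘ src) (a ∘ tgt) lab := by
  rw [cospanIncl_mk, graph_comp_graph H]
  refine graph_congr (Equiv.refl V) (Equiv.sumEmpty E Empty) (fun _ => rfl) (fun _ => rfl) ?_ ?_ ?_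
  all_goals exact Sum.rec (fun _ => rfl) isEmptyElim

theorem graph_tensor_graph (inp : Fin m → N) (out : Fin n → N) (src tgt : E → N) (lab : E → L)
    (inp' : Fin m' → M) (out' : Fin n' → M) (src' tgt' : E' → M) (lab' : E' → L) :
    graph inp out src tgt lab ⊗ graph inp' out' src' tgt' lab' =
      graph (Sum.map inp inp' ∘ finSumFinEquiv.symm) (Sum.map out out' ∘ finSumFinEquiv.symm)
        (Sum.map src src') (Sum.map tgt tgt') (Sum.elim lab lab') :=
  let c := Circuit.tensor ⟨⟨N, inferInstance, inp, out⟩, E, inferInstance, src, tgt, lab⟩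
    ⟨⟨M, inferInstance, inp', out'⟩, E', inferInstance, src', tgt', lab'⟩
  Quotient.sound (Setoid.trans (Circuit.ofEquiv_comp _ _)
    (Circuit.comp_ofEquiv (c.reindex finSumFinEquiv.symm id) finSumFinEquiv))

theorem graph_tensor_graph_fin {E E' : Type} [Finite E] [Finite E'] (inp : Fin m → Fin q)
    (out : Fin n → Fin q) (src tgt : E → Fin q) (lab : E → L) (inp' : Fin m' → Fin q')
    (out' : Fin n' → Fin q') (src' tgt' : E' → Fin q') (lab' : E' → L) :
    graph inp out src tgt lab ⊗ graph inp' out' src' tgt' lab' =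
      graph (finSumMap inp inp') (finSumMap out out') (finSumFinEquiv ∘ Sum.map src src')
        (finSumFinEquiv ∘ Sum.map tgt tgt') (Sum.elim lab lab') := by
  rw [graph_tensor_graph]
  exact graph_congr finSumFinEquiv (Equiv.refl _) (fun _ => rfl) (fun _ => rfl) (fun _ => rfl)
    (fun _ => rfl) fun _ => rfl

end Graph

/-! ## Evaluation of circuits -/

section Eval

variable {T : PROP.{w}} (f : PROP.Morphism FinCospan T)

/-- The value in `T` of a graph with nodes `Fin q`, whose edge `e` has the value `a e` and whose
nodes are interpreted by `f`. -/
noncomputable def graphValue {E : Type} (inp : Fin m → Fin q) (out : Fin n → Fin q)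
    (src tgt : E → Fin q) (a : E → T.Hom 1 1) : T.Hom m n :=
  f.map (fwd inp) ≫ attachEdges f a src tgt ≫ f.map (bwd out)

theorem graphValue_congr {E E' : Type} [Finite E] (σ : Fin q ≃ Fin q') (ε : E ≃ E')
    {inp : Fin m → Fin q} {out : Fin n → Fin q} {src tgt : E → Fin q} {a : E → T.Hom 1 1}
    {inp' : Fin m → Fin q'} {out' : Fin n → Fin q'} {src' tgt' : E' → Fin q'}
    {a' : E' → T.Hom 1 1} (hinp : ∀ x, σ (inp x) = inp' x) (hout : ∀ x, σ (out x) = out' x)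
    (hsrc : ∀ e, σ (src e) = src' (ε e)) (htgt : ∀ e, σ (tgt e) = tgt' (ε e))
    (ha : ∀ e, a e = a' (ε e)) :
    graphValue f inp out src tgt a = graphValue f inp' out' src' tgt' a' := by
  obtain rfl : σ ∘ inp = inp' := funext hinp
  obtain rfl : σ ∘ out = out' := funext hout
  obtain rfl : a = a' ∘ ε := funext ha
  have src_comp : src' ∘ ε = σ ∘ src := funext fun e => (hsrc e).symm
  have tgt_comp : tgt' ∘ ε = σ ∘ tgt := funext fun e => (htgt e).symm
  rw [graphValue, graphValue, ← attachEdges_comp_equiv f ε a', src_comp, tgt_comp, ← fwd_comp_fwd,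
    ← bwd_comp_bwd, f.map_comp, f.map_comp, T.assoc, ← T.assoc (f.map (fwd σ)),
    ← attachEdges_comp_fwd, T.assoc, ← T.assoc (f.map (fwd σ)), ← f.map_comp, fwd_equiv_comp_bwd,
    f.map_id, T.id_comp]

theorem graphValue_comp_graphValue {r : ℕ} {E E' : Type} [Finite E] [Finite E']
    {inp : Fin m → Fin q} {out : Fin n → Fin q} {inp' : Fin n → Fin q'} {out' : Fin p → Fin q'}
    {i : Fin q → Fin r} {j : Fin q' → Fin r} (H : IsPushoutSquare out inp' i j)
    (src tgt : E → Fin q) (src' tgt' : E' → Fin q') (a : E → T.Hom 1 1) (a' : E' → T.Hom 1 1) :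
    graphValue f inp out src tgt a ≫ graphValue f inp' out' src' tgt' a' =
      graphValue f (i ∘ inp) (j ∘ out') (Sum.elim (i ∘ src) (j ∘ src'))
        (Sum.elim (i ∘ tgt) (j ∘ tgt')) (Sum.elim a a') := by
  calc graphValue f inp out src tgt a ≫ graphValue f inp' out' src' tgt' a'
    _ = f.map (fwd inp) ≫ attachEdges f a src tgt ≫ f.map (bwd out ≫ fwd inp') ≫
          attachEdges f a' src' tgt' ≫ f.map (bwd out') := by
      simp only [graphValue, T.assoc, f.map_comp]
    _ = f.map (fwd inp) ≫ (attachEdges f a src tgt ≫ f.map (fwd i)) ≫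
          (f.map (bwd j) ≫ attachEdges f a' src' tgt') ≫ f.map (bwd out') := by
      simp only [bwd_comp_fwd H, T.assoc, f.map_comp]
    _ = f.map (fwd inp ≫ fwd i) ≫ (attachEdges f a (i ∘ src) (i ∘ tgt) ≫
          attachEdges f a' (j ∘ src') (j ∘ tgt')) ≫ f.map (bwd j ≫ bwd out') := by
      simp only [attachEdges_comp_fwd, ← attachEdges_comp_bwd, T.assoc, f.map_comp]
    _ = _ := by
      rw [fwd_comp_fwd, bwd_comp_bwd, graphValue, attachEdges_sum]
      rfl

theorem graphValue_tensor_graphValue {E E' : Type} [Finite E] [Finite E'] (inp : Fin m → Fin q)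
    (out : Fin n → Fin q) (src tgt : E → Fin q) (a : E → T.Hom 1 1) (inp' : Fin m' → Fin q')
    (out' : Fin n' → Fin q') (src' tgt' : E' → Fin q') (a' : E' → T.Hom 1 1) :
    graphValue f inp out src tgt a ⊗ graphValue f inp' out' src' tgt' a' =
      graphValue f (finSumMap inp inp') (finSumMap out out') (finSumFinEquiv ∘ Sum.map src src')
        (finSumFinEquiv ∘ Sum.map tgt tgt') (Sum.elim a a') := by
  simp only [graphValue, T.tensor_comp, ← f.map_tensor, ← attachEdges_tensor, fwd_tensor_fwd,
    bwd_tensor_bwd]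

theorem map_graphValue {S : PROP.{u}} {E : Type} [Finite E] (h : PROP.Morphism T S)
    (inp : Fin m → Fin q) (out : Fin n → Fin q) (src tgt : E → Fin q) (a : E → T.Hom 1 1) :
    h.map (graphValue f inp out src tgt a) =
      graphValue (f.comp h) inp out src tgt (h.map ∘ a) := by
  rw [graphValue, h.map_comp, h.map_comp, map_attachEdges]
  rfl

variable (g : L → T.Hom 1 1)

/-- The value in `T` of a circuit, with edges labelled `l` interpreted by `g l` and nodes
interpreted by `f`. -/
noncomputable def eval : (Circ L).Hom m n → T.Hom m n :=
  Quotient.lift (fun c : Circuit L (Fin m) (Fin n) =>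
    let e := Finite.equivFin c.N
    graphValue f (e ∘ c.inp) (e ∘ c.out) (e ∘ c.src) (e ∘ c.tgt) (g ∘ c.lab)) <| by
  rintro c d ⟨σ, ε, hinp, hout, hsrc, htgt, hlab⟩
  refine graphValue_congr f ((Finite.equivFin c.N).symm.trans (σ.trans (Finite.equivFin d.N))) ε
    ?_ ?_ ?_ ?_ fun e => congrArg g (hlab e)
  all_goals simp [hinp, hout, hsrc, htgt]

theorem eval_graph {E : Type} [Finite E] (inp : Fin m → Fin q) (out : Fin n → Fin q)
    (src tgt : E → Fin q) (lab : E → L) :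
    eval f g (graph inp out src tgt lab) = graphValue f inp out src tgt (g ∘ lab) :=
  graphValue_congr f (Finite.equivFin (Fin q)).symm (Equiv.refl E) (by simp) (by simp) (by simp)
    (by simp) fun _ => rfl

theorem eval_comp (x : (Circ L).Hom m n) (y : (Circ L).Hom n p) :
    eval f g (x ≫ y) = eval f g x ≫ eval f g y := by
  obtain ⟨q, inp, out, E, _, src, tgt, lab, rfl⟩ := exists_eq_graph x
  obtain ⟨q', inp', out', E', _, src', tgt', lab', rfl⟩ := exists_eq_graph y
  obtain ⟨r, a, b, H⟩ := IsPushoutSquare.exists_fin out inp'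
  rw [graph_comp_graph H, eval_graph, eval_graph, eval_graph, graphValue_comp_graphValue f H,
    Sum.comp_elim]

theorem eval_tensor (x : (Circ L).Hom m n) (y : (Circ L).Hom m' n') :
    eval f g (x ⊗ y) = eval f g x ⊗ eval f g y := by
  obtain ⟨q, inp, out, E, _, src, tgt, lab, rfl⟩ := exists_eq_graph x
  obtain ⟨q', inp', out', E', _, src', tgt', lab', rfl⟩ := exists_eq_graph y
  rw [graph_tensor_graph_fin, eval_graph, eval_graph, eval_graph, graphValue_tensor_graphValue,
    Sum.comp_elim]

theorem eval_cospanIncl (x : FinCospan.Hom m n) : eval f g ((cospanIncl L).map x) = f.map x := by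
  obtain ⟨q, inp, out, rfl⟩ := exists_eq_fwd_comp_bwd x
  rw [fwd_comp_bwd, cospanIncl_mk, eval_graph, graphValue, attachEdges_of_isEmpty, T.id_comp,
    ← f.map_comp, fwd_comp_bwd]

theorem eval_edge (l : L) : eval f g (edge l) = g l := by
  have castAdd_eq : (Fin.castAdd 1 : Fin 1 → Fin 2) = fun _ => 0 := funext (by simp)
  have natAdd_eq : (Fin.natAdd 1 : Fin 1 → Fin 2) = fun _ => 1 := funext (by simp)
  have value := fwd_castAdd_comp_attach_comp_bwd_natAdd f (g l)
  rw [castAdd_eq, natAdd_eq] at value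
  rwa [edge, eval_graph, graphValue, attachEdges_of_unique]

/-- The morphism out of `Circ L` with prescribed values on cospans and on edges. -/
noncomputable def desc : PROP.Morphism (Circ L) T where
  map := eval f g
  map_id n := (eval_cospanIncl f g (FinCospan.id n)).trans (f.map_id n)
  map_comp := eval_comp f g
  map_tensor := eval_tensor f g
  map_braid m n := (eval_cospanIncl f g (FinCospan.braid m n)).trans (f.map_braid m n)

end Eval

/-! ## Circuits are generated by cospans and edges -/

theorem graph_eq_fwd_comp_graph_comp_bwd {E : Type} [Finite E] (inp : Fin m → Fin q)
    (out : Fin n → Fin q) (src tgt : E → Fin q) (lab : E → L) :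
    graph inp out src tgt lab =
      (cospanIncl L).map (fwd inp) ≫ graph id id src tgt lab ≫ (cospanIncl L).map (bwd out) := by
  rw [fwd, bwd, graph_comp_cospanIncl_mk (.id_left id)]
  exact (cospanIncl_mk_comp_graph (.id_left id)).symm

theorem edge_tensor_id (l : L) (n : ℕ) :
    edge l ⊗ (Circ L).id n =
      graph (Sum.map id (Fin.natAdd 1) ∘ finSumFinEquiv.symm) Sum.inr
        (fun _ : Unit => (Sum.inl 0 : Fin 1 ⊕ Fin (1 + n)))
        (fun _ => Sum.inr (Fin.castAdd n 0)) fun _ => l := by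
  let nodes : Fin 2 ⊕ Fin n ≃ Fin 1 ⊕ Fin (1 + n) :=
    (Equiv.sumCongr (finSumFinEquiv (m := 1) (n := 1)).symm (Equiv.refl _)).trans
      ((Equiv.sumAssoc _ _ _).trans (Equiv.sumCongr (Equiv.refl _) finSumFinEquiv))
  rw [← (cospanIncl L).map_id, ← fwd_id, fwd, cospanIncl_mk, edge, graph_tensor_graph]
  refine graph_congr nodes (Equiv.sumEmpty Unit Empty) ?_ ?_ ?_ ?_ ?_
  · refine finSumFinEquiv.surjective.forall.2 (Sum.rec (fun x => ?_) fun x => ?_)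
    · obtain rfl := Subsingleton.elim x 0
      rfl
    · simp [nodes]
  · refine finSumFinEquiv.surjective.forall.2 (Sum.rec (fun x => ?_) fun x => ?_)
    · obtain rfl := Subsingleton.elim x 0
      rfl
    · simp [nodes]
  all_goals exact Sum.rec (fun _ => rfl) isEmptyElim

theorem edge_tensor_id_comp_fwd (l : L) (t : Fin n) :
    (edge l ⊗ (Circ L).id n) ≫ (cospanIncl L).map (fwd (Fin.append (fun _ : Fin 1 => t) id)) =
      graph finSumFinEquiv.symm Sum.inr (fun _ : Unit => (Sum.inl 0 : Fin 1 ⊕ Fin n))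
        (fun _ => Sum.inr t) fun _ => l := by
  have append_comp_natAdd : Fin.append (fun _ : Fin 1 => t) id ∘ Fin.natAdd 1 = id :=
    funext (Fin.append_right _ _)
  rw [edge_tensor_id, fwd, graph_comp_cospanIncl_mk (.inr_sumMap _)]
  congr 1
  rw [← Function.comp_assoc, Sum.map_comp_map, append_comp_natAdd, Function.id_comp, Sum.map_id_id,
    Function.id_comp]

theorem attachEdge_edge (l : L) (s t : Fin n) :
    attachEdge (cospanIncl L) (edge l) s t =
      graph id id (fun _ : Unit => s) (fun _ => t) fun _ => l := by
  rw [attachEdge, attach, edge_tensor_id_comp_fwd, bwd,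
    cospanIncl_mk_comp_graph (.equiv_right _ finSumFinEquiv.symm)]
  congr 1 <;> simp [funext_iff]

theorem attachEdges_edge {E : Type} [Finite E] (src tgt : E → Fin n) (lab : E → L) :
    attachEdges (cospanIncl L) (edge ∘ lab) src tgt = graph id id src tgt lab := by
  refine Finite.induction_empty_option (P := fun E => ∀ [Finite E] (src tgt : E → Fin n)
    (lab : E → L), attachEdges (cospanIncl L) (edge ∘ lab) src tgt = graph id id src tgt lab)
    ?_ ?_ ?_ E src tgt lab
  · intro E E' ε ih _ src tgt lab
    have := Finite.of_equiv E' ε.symm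
    rw [← attachEdges_comp_equiv _ ε, Function.comp_assoc, ih]
    exact graph_congr (Equiv.refl _) ε (fun _ => rfl) (fun _ => rfl) (fun _ => rfl) (fun _ => rfl)
      fun _ => rfl
  · intro _ src tgt lab
    rw [attachEdges_of_isEmpty, graph_of_isEmpty, ← (cospanIncl L).map_id]
    rfl
  · intro E _ ih _ src tgt lab
    let ε : E ⊕ Unit ≃ Option E := (Equiv.optionEquivSumPUnit E).symm
    rw [← attachEdges_comp_equiv _ ε, attachEdges_sum, attachEdges_of_unique (E := Unit),
      Function.comp_assoc, Function.comp_assoc, ih]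
    refine (congrArg _ (attachEdge_edge _ _ _)).trans ((graph_comp_graph (.id_left id)).trans ?_)
    refine graph_congr (Equiv.refl _) ε (fun _ => rfl) (fun _ => rfl) ?_ ?_ ?_
    all_goals exact Sum.rec (fun _ => rfl) fun _ => rfl

theorem graphValue_edge {E : Type} [Finite E] (inp : Fin m → Fin q) (out : Fin n → Fin q)
    (src tgt : E → Fin q) (lab : E → L) :
    graphValue (cospanIncl L) inp out src tgt (edge ∘ lab) = graph inp out src tgt lab := by
  rw [graphValue, attachEdges_edge, ← graph_eq_fwd_comp_graph_comp_bwd]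

theorem map_eq_eval {T : PROP.{w}} (h : PROP.Morphism (Circ L) T) (x : (Circ L).Hom m n) :
    h.map x = eval ((cospanIncl L).comp h) (fun l => h.map (edge l)) x := by
  obtain ⟨q, inp, out, E, _, src, tgt, lab, rfl⟩ := exists_eq_graph x
  rw [eval_graph, ← graphValue_edge, map_graphValue]
  rfl

theorem existsUnique_morphism {T : PROP.{w}} (f : PROP.Morphism FinCospan T) (g : L → T.Hom 1 1) :
    ∃! h : PROP.Morphism (Circ L) T,
      (cospanIncl L).comp h = f ∧ ∀ l, h.map (edge l) = g l := by
  refine ⟨desc f g, ⟨?_, eval_edge f g⟩, ?_⟩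
  · ext m n x
    exact eval_cospanIncl f g x
  · rintro h ⟨rfl, hg⟩
    obtain rfl : (fun l => h.map (edge l)) = g := funext hg
    ext m n x
    exact map_eq_eval h x

end Circ

namespace freeProp

theorem morphism_ext {S : ℕ → ℕ → Type u} {T : PROP.{w}} {F G : PROP.Morphism (freeProp S) T}
    (h : ∀ m n (s : S m n), F.map (of s) = G.map (of s)) : F = G := by
  have map_mk {m n : ℕ} (x : PropTerm S m n) :
      F.map (Quotient.mk (PropTerm.setoid S m n) x) =
        G.map (Quotient.mk (PropTerm.setoid S m n) x) := by
    induction x with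
    | gen s => exact h _ _ s
    | id n => exact (F.map_id n).trans (G.map_id n).symm
    | comp x y ihx ihy =>
      exact (F.map_comp (Quotient.mk _ x) (Quotient.mk _ y)).trans
        ((congrArg₂ T.comp ihx ihy).trans (G.map_comp _ _).symm)
    | tensor x y ihx ihy =>
      exact (F.map_tensor (Quotient.mk _ x) (Quotient.mk _ y)).trans
        ((congrArg₂ T.tensor ihx ihy).trans (G.map_tensor _ _).symm)
    | braid m n => exact (F.map_braid m n).trans (G.map_braid m n).symm
  ext m n ⟨x⟩
  exact map_mk x

end freeProp

theorem labelProp.morphism_ext {L : Type v} {T : PROP.{w}} {F G : PROP.Morphism (labelProp L) T}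
    (h : ∀ l, F.map (freeProp.of (LabelSig.label l)) = G.map (freeProp.of (LabelSig.label l))) :
    F = G :=
  freeProp.morphism_ext fun _ _ s => match s with
    | .label l => h l

theorem mainTheorem3 (k : Type u) [Field k] (L : Type v) :
    PROP.IsCoproduct.{w, 1, v, max 1 v} (cospanIncl L) (labelIncl L) ∧
    (∃! K : PROP.Morphism FinCorel (LagRel k), SendsFrobenius K) ∧
    ∀ K : PROP.Morphism FinCorel (LagRel k), SendsFrobenius K →
      ∀ R : L → (LagRel k).Hom 1 1,
        ∃! B : PROP.Morphism (Circ L) (LagRel k),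
          (cospanIncl L).comp B = cospanToCorel.comp K ∧
          ∀ l : L, ((labelIncl L).comp B).map (freeProp.of (LabelSig.label l)) = R l := by
  refine ⟨fun T f g => ?_, ?_, fun K _ R => Circ.existsUnique_morphism (cospanToCorel.comp K) R⟩
  · obtain ⟨h, ⟨h_cospan, h_edge⟩, h_unique⟩ :=
      Circ.existsUnique_morphism f fun l => g.map (freeProp.of (LabelSig.label l))
    refine ⟨h, ⟨h_cospan, labelProp.morphism_ext h_edge⟩, ?_⟩
    rintro h' ⟨h'_cospan, rfl⟩
    exact h_unique h' ⟨h'_cospan, fun _ => rfl⟩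
  · exact ⟨corelToLagRel k, corelToLagRel_sendsFrobenius,
      fun K hK => hK.unique corelToLagRel_sendsFrobenius⟩
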